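/- Let $k$ be an algebraically closed field (for instance $k=\mathbb C$) and let $\mathcal C$ be a finite ribbon category over $k$: a $k$-linear abelian category with finite-dimensional morphism spaces, all objects of finite length, enough projectives and finitely many isomorphism classes of simple objects, equipped with a $k$-bilinear rigid monoidal structure with simple tensor unit $\mathbf 1$, a braiding $\beta$, and a twist $\theta$ (a natural automorphism of the identity functor with $\theta_{x\otimes y}=\beta_{y,x}\circ\beta_{x,y}\circ(\theta_x\otimes\theta_y)$ and $\theta_{x^\vee}=(\theta_x)^\vee$). Let $\mathrm{ev}_x\colon x^\vee\otimes x\to\mathbf 1$ and $\mathrm{coev}_x\colon\mathbf 1\to x\otimes x^\vee$ be the duality morphisms, put $\widetilde{\mathrm{ev}}_x:=\mathrm{ev}_x\circ\beta_{x,x^\vee}\circ(\theta_x\otimes\mathrm{id})\colon x\otimes x^\vee\to\mathbf 1$ and $\widetilde{\mathrm{coev}}_x:=(\mathrm{id}\otimes\theta_x)\circ\beta_{x,x^\vee}\circ\mathrm{coev}_x\colon\mathbf 1\to x^\vee\otimes x$, and identify $x$ with $x^{\vee\vee}$ through the induced pivotal structure. (Associativity and unit constraints are suppressed.) Then the coend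 $L=\int^{x\in\mathcal C}x^\vee\otimes x$ exists. Let $\imath_x\colon x^\vee\otimes x\to L$ be its universal dinatural family. The formulas $$\mu\circ(\imath_x\otimes\imath_y)=\imath_{y\otimes x}\circ(\mathrm{id}_{x^\vee}\otimes\beta_{x,y^\vee\otimes y}),\qquad \eta=\imath_{\mathbf 1},$$ $$\Delta\circ\imath_x=(\imath_x\otimes\imath_x)\circ(\mathrm{id}_{x^\vee}\otimes\mathrm{coev}_x\otimes\mathrm{id}_x),\qquad \varepsilon\circ\imath_x=\mathrm{ev}_x$$ (with $x^\vee\otimes y^\vee$ identified with $(y\otimes x)^\vee$) make $L$ an algebra and a coalgebra in $\mathcal C$. Hence, with the addition of morphisms, $\mathrm{Hom}_{\mathcal C}(L,\mathbf 1)$ is a ring with the convolution product $\alpha*\beta=(\alpha\otimes\beta)\circ\Delta$ and unit $\varepsilon$, and $\mathrm{Hom}_{\mathcal C}(\mathbf 1,L)$ is a ring with the convolution product $\hat\alpha*\hat\beta=\mu\circ(\hat\alpha\otimes\hat\beta)$ and unit $\eta$. For an object $m$ of $\mathcal C$ let $\rho_m\colon L\otimes m\to m$ and $\delta_m\colon m\to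 L\otimes m$ be given by $$\rho_m\circ(\imath_x\otimes\mathrm{id}_m)=(\mathrm{ev}_x\otimes\mathrm{id}_m)\circ\big(\mathrm{id}_{x^\vee}\otimes(\beta_{m,x}\circ\beta_{x,m})\big),\qquad \delta_m=(\imath_{m^\vee}\otimes\mathrm{id}_m)\circ(\mathrm{id}_m\otimes\widetilde{\mathrm{coev}}_m),$$ and define the character $\chi^L_m\in\mathrm{Hom}_{\mathcal C}(L,\mathbf 1)$ and the cocharacter $\hat\chi^L_m\in\mathrm{Hom}_{\mathcal C}(\mathbf 1,L)$ as the partial traces $$\chi^L_m=\widetilde{\mathrm{ev}}_m\circ(\rho_m\otimes\mathrm{id}_{m^\vee})\circ(\mathrm{id}_L\otimes\mathrm{coev}_m),\qquad \hat\chi^L_m=(\mathrm{id}_L\otimes\widetilde{\mathrm{ev}}_m)\circ(\delta_m\otimes\mathrm{id}_{m^\vee})\circ\mathrm{coev}_m .$$ Let $K_0(\mathcal C)$ be the Grothendieck ring of $\mathcal C$, with $[m]=[m']+[m'']$ for every short exact sequence $0\to m'\to m\to m''\to0$, product $[m][n]=[m\otimes n]$ and unit $[\mathbf 1]$. Then the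 assignments $[m]\mapsto\chi^L_m$ and $[m]\mapsto\hat\chi^L_m$ define (unital) ring homomorphisms $$\chi^L\colon K_0(\mathcal C)\to\mathrm{Hom}_{\mathcal C}(L,\mathbf 1)\qquad\text{and}\qquad \hat\chi^L\colon K_0(\mathcal C)\to\mathrm{Hom}_{\mathcal C}(\mathbf 1,L).$$ -/

import Mathlib

open CategoryTheory MonoidalCategory Limits Opposite

universe w v u

noncomputable section

namespace FiniteRibbon

section FiniteCategories

/-- An object has finite length: it has a finite filtration with simple subquotients. -/
inductive HasFiniteLength {C : Type u} [Category.{v} C] [Abelian C] : C → Prop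
  | zero (X : C) (hX : IsZero X) : HasFiniteLength X
  | extension (S : ShortComplex C) (hS : S.ShortExact) (h₁ : HasFiniteLength S.X₁)
      (h₃ : Simple S.X₃) : HasFiniteLength S.X₂

/-- A `k`-linear (abelian) category is *finite*. -/
class IsFiniteCategory (k : Type w) [Field k] (C : Type u) [Category.{v} C] [Abelian C]
    [Linear k C] : Prop where
  finite_hom : ∀ X Y : C, FiniteDimensional k (X ⟶ Y)
  finite_length : ∀ X : C, HasFiniteLength X
  enough_projectives : EnoughProjectives C
  finite_simples : ∃ (n : ℕ) (S : Fin n → C), ∀ X : C, Simple X → ∃ i, Nonempty (X ≅ S i)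

end FiniteCategories

section GrothendieckRing

variable (C : Type u) [Category.{v} C] [Abelian C]

/-- The relations `[X₂] = [X₁] + [X₃]`, one for every short exact sequence. -/
def K0.relations : AddSubgroup (FreeAbelianGroup C) :=
  AddSubgroup.closure {a | ∃ S : ShortComplex C, S.ShortExact ∧
    a = FreeAbelianGroup.of S.X₂ - (FreeAbelianGroup.of S.X₁ + FreeAbelianGroup.of S.X₃)}

/-- The Grothendieck group of an abelian category. -/
def K0 : Type u := FreeAbelianGroup C ⧸ K0.relations C

namespace K0

instance : AddCommGroup (K0 C) := inferInstanceAs (AddCommGroup (FreeAbelianGroup C ⧸ relations C))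

variable {C}

/-- The projection from the free abelian group on the objects. -/
def proj : FreeAbelianGroup C →+ K0 C := QuotientAddGroup.mk' (relations C)

/-- The class of an object. -/
def mk (X : C) : K0 C := proj (FreeAbelianGroup.of X)

lemma mk_shortExact {S : ShortComplex C} (hS : S.ShortExact) :
    mk S.X₂ = mk S.X₁ + mk S.X₃ := by
  unfold mk
  rw [← map_add, ← sub_eq_zero, ← map_sub]
  exact (QuotientAddGroup.eq_zero_iff _).2 (AddSubgroup.subset_closure ⟨S, hS, rfl⟩)

/-- An additive function on objects induces a homomorphism on the Grothendieck group. -/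
def lift {A : Type*} [AddCommGroup A] (f : C → A)
    (hf : ∀ S : ShortComplex C, S.ShortExact → f S.X₂ = f S.X₁ + f S.X₃) : K0 C →+ A :=
  QuotientAddGroup.lift (relations C) (FreeAbelianGroup.lift f) (by
    rw [relations, AddSubgroup.closure_le]
    rintro _ ⟨S, hS, rfl⟩
    simp [hf S hS])

@[simp]
lemma lift_mk {A : Type*} [AddCommGroup A] (f : C → A)
    (hf : ∀ S : ShortComplex C, S.ShortExact → f S.X₂ = f S.X₁ + f S.X₃) (X : C) :
    lift f hf (mk X) = f X :=
  FreeAbelianGroup.lift_apply_of f X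

lemma hom_ext {A : Type*} [AddCommGroup A] {f g : K0 C →+ A} (h : ∀ X, f (mk X) = g (mk X)) :
    f = g := by
  apply QuotientAddGroup.addMonoidHom_ext
  apply FreeAbelianGroup.lift_ext
  exact h

lemma mk_eq_zero {X : C} (hX : IsZero X) : mk X = 0 := by
  have h : (ShortComplex.mk (0 : X ⟶ X) (0 : X ⟶ X) (by simp)).ShortExact :=
    { exact := ShortComplex.exact_of_isZero_X₂ _ hX
      mono_f := ⟨fun _ _ _ => hX.eq_of_tgt _ _⟩
      epi_g := ⟨fun _ _ _ => hX.eq_of_src _ _⟩ }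
  simpa using mk_shortExact h

lemma mk_iso {X Y : C} (e : X ≅ Y) : mk X = mk Y := by
  obtain ⟨Z, hZ⟩ := HasZeroObject.zero (C := C)
  have h : (ShortComplex.mk (0 : Z ⟶ X) e.hom (by simp)).ShortExact :=
    { exact := (ShortComplex.exact_iff_mono _ rfl).2 inferInstance
      mono_f := ⟨fun _ _ _ => hZ.eq_of_tgt _ _⟩
      epi_g := inferInstanceAs (Epi e.hom) }
  have := mk_shortExact h
  simpa [mk_eq_zero hZ] using this

@[elab_as_elim]
lemma induction {p : K0 C → Prop} (a : K0 C) (mk : ∀ X, p (mk X)) (zero : p 0)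
    (neg : ∀ a, p a → p (-a)) (add : ∀ a b, p a → p b → p (a + b)) : p a := by
  obtain ⟨a, rfl⟩ := QuotientAddGroup.mk'_surjective (relations C) a
  induction a using FreeAbelianGroup.induction_on with
  | zero => exact zero
  | of X => exact mk X
  | neg X h => exact neg _ h
  | add a b ha hb => exact add _ _ ha hb

variable [MonoidalCategory C]

instance : One (K0 C) := ⟨mk (𝟙_ C)⟩

lemma one_def : (1 : K0 C) = mk (𝟙_ C) := rfl

variable [MonoidalPreadditive C] [RigidCategory C]

lemma shortExact_tensorLeft (X : C) {S : ShortComplex C} (hS : S.ShortExact) :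
    (S.map (tensorLeft X)).ShortExact := by
  have : PreservesFiniteColimits (tensorLeft X) :=
    have := (tensorLeftAdjunction (ᘁX) X).leftAdjoint_preservesColimits
    inferInstance
  have : PreservesFiniteLimits (tensorLeft X) :=
    have := (tensorLeftAdjunction X (Xᘁ)).rightAdjoint_preservesLimits
    inferInstance
  exact hS.map_of_exact _

lemma shortExact_tensorRight (X : C) {S : ShortComplex C} (hS : S.ShortExact) :
    (S.map (tensorRight X)).ShortExact := by
  have : PreservesFiniteColimits (tensorRight X) :=
    have := (tensorRightAdjunction X (Xᘁ)).leftAdjoint_preservesColimits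
    inferInstance
  have : PreservesFiniteLimits (tensorRight X) :=
    have := (tensorRightAdjunction (ᘁX) X).rightAdjoint_preservesLimits
    inferInstance
  exact hS.map_of_exact _

lemma mk_tensorLeft (X : C) (S : ShortComplex C) (hS : S.ShortExact) :
    mk (X ⊗ S.X₂) = mk (X ⊗ S.X₁) + mk (X ⊗ S.X₃) :=
  mk_shortExact (shortExact_tensorLeft X hS)

lemma mk_tensorRight (X : C) (S : ShortComplex C) (hS : S.ShortExact) :
    mk (S.X₂ ⊗ X) = mk (S.X₁ ⊗ X) + mk (S.X₃ ⊗ X) :=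
  mk_shortExact (shortExact_tensorRight X hS)

/-- The multiplication `[X] * [Y] = [X ⊗ Y]`, which exists because `⊗` is exact. -/
def mulHom : K0 C →+ K0 C →+ K0 C :=
  lift (fun X => lift (fun Y => mk (X ⊗ Y)) (mk_tensorLeft X))
    (fun S hS => hom_ext (fun Y => by
      rw [AddMonoidHom.add_apply, lift_mk, lift_mk, lift_mk]
      exact mk_tensorRight Y S hS))

instance : Mul (K0 C) := ⟨fun a b => mulHom a b⟩

lemma mul_def (a b : K0 C) : a * b = mulHom a b := rfl

@[simp]
lemma mk_mul_mk (X Y : C) : mk X * mk Y = mk (X ⊗ Y) := by rw [mul_def, mulHom, lift_mk, lift_mk]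

/-- The Grothendieck ring of a rigid monoidal abelian category. -/
instance : Ring (K0 C) where
  __ := (inferInstance : AddCommGroup (K0 C))
  left_distrib a b c := map_add (mulHom a) b c
  right_distrib a b c := by simp [mul_def]
  zero_mul a := by simp [mul_def]
  mul_zero a := by simp [mul_def]
  mul_assoc a b c := by
    have h : ∀ X Y (c : K0 C), mk X * mk Y * c = mk X * (mk Y * c) := fun X Y c => by
      induction c using induction with
      | mk Z => simpa using mk_iso (α_ X Y Z)
      | zero => simp [mul_def]
      | neg a h => simpa [mul_def] using h
      | add a b ha hb => simp only [mul_def, map_add] at *; rw [ha, hb]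
    have h' : ∀ X (b c : K0 C), mk X * b * c = mk X * (b * c) := fun X b c => by
      induction b using induction with
      | mk Y => exact h X Y c
      | zero => simp [mul_def]
      | neg a h => simpa [mul_def] using h
      | add a b ha hb => simp only [mul_def, map_add, AddMonoidHom.add_apply] at *; rw [ha, hb]
    induction a using induction with
    | mk X => exact h' X b c
    | zero => simp [mul_def]
    | neg a h => simpa [mul_def] using h
    | add a b ha hb => simp only [mul_def, map_add, AddMonoidHom.add_apply] at *; rw [ha, hb]
  one_mul a := by
    induction a using induction with
    | mk X => simpa [one_def] using mk_iso (λ_ X)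
    | zero => simp [mul_def]
    | neg a h => simpa [mul_def] using h
    | add a b ha hb => simp only [mul_def, map_add] at *; rw [ha, hb]
  mul_one a := by
    induction a using induction with
    | mk X => simpa [one_def] using mk_iso (ρ_ X)
    | zero => simp [mul_def]
    | neg a h => simpa [mul_def] using h
    | add a b ha hb => simp only [mul_def, map_add, AddMonoidHom.add_apply] at *; rw [ha, hb]

end K0
end GrothendieckRing

section Convolution

variable {C : Type u} [Category.{v} C] [Preadditive C] [MonoidalCategory C]
  [MonoidalPreadditive C] {M N : C}

instance : AddCommGroup (Conv M N) := inferInstanceAs (AddCommGroup (M ⟶ N))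

open MonObj ComonObj

lemma conv_add [ComonObj M] [MonObj N] (f g h : M ⟶ N) :
    Δ[M] ≫ f ▷ M ≫ N ◁ (g + h) ≫ μ[N] =
      Δ[M] ≫ f ▷ M ≫ N ◁ g ≫ μ[N] + Δ[M] ≫ f ▷ M ≫ N ◁ h ≫ μ[N] := by
  simp [MonoidalPreadditive.whiskerLeft_add, Preadditive.comp_add, Preadditive.add_comp]

lemma add_conv [ComonObj M] [MonObj N] (f g h : M ⟶ N) :
    Δ[M] ≫ (f + g) ▷ M ≫ N ◁ h ≫ μ[N] =
      Δ[M] ≫ f ▷ M ≫ N ◁ h ≫ μ[N] + Δ[M] ≫ g ▷ M ≫ N ◁ h ≫ μ[N] := by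
  simp [MonoidalPreadditive.add_whiskerRight, Preadditive.comp_add, Preadditive.add_comp]

lemma conv_zero [ComonObj M] [MonObj N] (f : M ⟶ N) :
    Δ[M] ≫ f ▷ M ≫ N ◁ (0 : M ⟶ N) ≫ μ[N] = 0 := by
  simp

lemma zero_conv [ComonObj M] [MonObj N] (f : M ⟶ N) :
    Δ[M] ≫ (0 : M ⟶ N) ▷ M ≫ N ◁ f ≫ μ[N] = 0 := by
  simp

/-- The convolution ring `Hom(M, N)` of a coalgebra `M` and an algebra `N`: its addition is that
of morphisms, its product is `f * g = μ ∘ (f ⊗ g) ∘ Δ` and its unit is `η ∘ ε`. -/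
instance [ComonObj M] [MonObj N] : Ring (Conv M N) where
  __ := (inferInstance : AddCommGroup (Conv M N))
  __ := (inferInstance : Monoid (Conv M N))
  left_distrib f g h := conv_add f g h
  right_distrib f g h := add_conv f g h
  zero_mul f := zero_conv f
  mul_zero f := conv_zero f

end Convolution


section Duality

variable {C : Type u} [Category.{v} C] [MonoidalCategory C] [RightRigidCategory C]

/-- The right dual `x^∨` of an object. -/
def dual (X : C) : C := Xᘁ

instance (X : C) : ExactPairing X (dual X) := inferInstanceAs (ExactPairing X Xᘁ)

/-- The right evaluation `x^∨ ⊗ x ⟶ 𝟙`. -/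
def ev (X : C) : dual X ⊗ X ⟶ 𝟙_ C := ε_ X (dual X)

/-- The right coevaluation `𝟙 ⟶ x ⊗ x^∨`. -/
def coev (X : C) : 𝟙_ C ⟶ X ⊗ dual X := η_ X (dual X)

/-- The dual morphism `f^∨ : y^∨ ⟶ x^∨` of `f : x ⟶ y`. -/
def dualMap {X Y : C} (f : X ⟶ Y) : dual Y ⟶ dual X := fᘁ

lemma dualMap_ev {X Y : C} (f : X ⟶ Y) : dualMap f ▷ X ≫ ev X = dual Y ◁ f ≫ ev Y :=
  rightAdjointMate_comp_evaluation f

lemma coev_dualMap {X Y : C} (f : X ⟶ Y) : coev Y ≫ Y ◁ dualMap f = coev X ≫ f ▷ dual X :=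
  coevaluation_comp_rightAdjointMate f

variable (C)

/-- The contravariant functor `x ↦ x^∨`. -/
def dualFunctor : Cᵒᵖ ⥤ C where
  obj X := dual X.unop
  map f := dualMap f.unop
  map_id _ := rightAdjointMate_id
  map_comp _ _ := comp_rightAdjointMate

/-- The functor `(x, y) ↦ x^∨ ⊗ y`, contravariant in `x` and covariant in `y`. -/
def dualTensor : Cᵒᵖ ⥤ C ⥤ C := dualFunctor C ⋙ curriedTensor C

end Duality

section Ribbon

/-- A ribbon category: a braided rigid monoidal category with a balancing (twist) `θ`, which is
compatible with the braiding and with the duality. -/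
class RibbonCategory (C : Type u) [Category.{v} C] [MonoidalCategory C] [BraidedCategory C]
    [RigidCategory C] where
  /-- The twist, a natural automorphism of the identity functor. -/
  twist : 𝟭 C ≅ 𝟭 C
  twist_tensor : ∀ X Y : C, twist.hom.app (X ⊗ Y) =
    (twist.hom.app X ⊗ₘ twist.hom.app Y) ≫ (β_ X Y).hom ≫ (β_ Y X).hom
  twist_dual : ∀ X : C, twist.hom.app (dual X) = dualMap (twist.hom.app X)

variable {C : Type u} [Category.{v} C] [MonoidalCategory C] [BraidedCategory C]
  [RigidCategory C] [RibbonCategory C]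

/-- The twist `θ_x : x ⟶ x`. -/
def twist (X : C) : X ⟶ X := (RibbonCategory.twist (C := C)).hom.app X

/-- The left evaluation `x ⊗ x^∨ ⟶ 𝟙` that is determined by the ribbon structure. -/
def tev (X : C) : X ⊗ dual X ⟶ 𝟙_ C := twist X ▷ dual X ≫ (β_ X (dual X)).hom ≫ ev X

/-- The left coevaluation `𝟙 ⟶ x^∨ ⊗ x` that is determined by the ribbon structure. -/
def tcoev (X : C) : 𝟙_ C ⟶ dual X ⊗ X := coev X ≫ (β_ X (dual X)).hom ≫ dual X ◁ twist X

/-- The pivotal structure `x ⟶ x^∨^∨`, through which an object is identified with its double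
dual; it is the transpose of the left evaluation. -/
def pivotal (X : C) : X ⟶ dual (dual X) :=
  (ρ_ X).inv ≫ X ◁ coev (dual X) ≫ (α_ _ _ _).inv ≫ tev X ▷ dual (dual X) ≫ (λ_ _).hom

end Ribbon

section Coend

variable (C : Type u) [Category.{v} C] [MonoidalCategory C] [RightRigidCategory C]

/-- A coend `L = ∫^x x^∨ ⊗ x`: an object with a universal dinatural family. -/
structure CanonicalCoend where
  /-- The object together with the dinatural family. -/
  cowedge : Cowedge (dualTensor C)
  /-- The universal property. -/
  isColimit : IsColimit cowedge

namespace CanonicalCoend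

variable {C}
variable (L : CanonicalCoend C)

/-- The underlying object of the coend. -/
def obj : C := L.cowedge.pt

/-- The dinatural family `ι_x : x^∨ ⊗ x ⟶ L`. -/
def ι (X : C) : dual X ⊗ X ⟶ L.obj := L.cowedge.π X

lemma condition {X Y : C} (f : X ⟶ Y) : dualMap f ▷ X ≫ L.ι X = dual Y ◁ f ≫ L.ι Y :=
  Cowedge.condition L.cowedge f

/-- The morphism out of `L` that is determined by a dinatural family. -/
def desc {Z : C} (f : ∀ X : C, dual X ⊗ X ⟶ Z)
    (hf : ∀ ⦃X Y : C⦄ (g : X ⟶ Y), dualMap g ▷ X ≫ f X = dual Y ◁ g ≫ f Y) : L.obj ⟶ Z :=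
  Cowedge.IsColimit.desc L.isColimit f hf

@[simp]
lemma ι_desc {Z : C} (f : ∀ X : C, dual X ⊗ X ⟶ Z)
    (hf : ∀ ⦃X Y : C⦄ (g : X ⟶ Y), dualMap g ▷ X ≫ f X = dual Y ◁ g ≫ f Y) (X : C) :
    L.ι X ≫ L.desc f hf = f X :=
  Cowedge.IsColimit.π_desc L.isColimit f hf X

lemma hom_ext {Z : C} {f g : L.obj ⟶ Z} (h : ∀ X, L.ι X ≫ f = L.ι X ≫ g) : f = g :=
  Cowedge.IsColimit.hom_ext L.isColimit h

/-- The functor `- ⊗ W` preserves the coend. -/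
def descRight {W Z : C} (f : ∀ X : C, (dual X ⊗ X) ⊗ W ⟶ Z)
    (hf : ∀ ⦃X Y : C⦄ (g : X ⟶ Y), (dualMap g ▷ X) ▷ W ≫ f X = (dual Y ◁ g) ▷ W ≫ f Y) :
    L.obj ⊗ W ⟶ Z :=
  (tensorRightHomEquiv L.obj W (dual W) Z).symm
    (L.desc (fun X => tensorRightHomEquiv (dual X ⊗ X) W (dual W) Z (f X)) (fun X Y g => by
      have h : ∀ {A B : C} (u : A ⟶ B) (v : B ⊗ W ⟶ Z),
          u ≫ tensorRightHomEquiv B W (dual W) Z v =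
            tensorRightHomEquiv A W (dual W) Z (u ▷ W ≫ v) := fun u v => by
        rw [← Equiv.symm_apply_eq, tensorRightHomEquiv_symm_naturality, Equiv.symm_apply_apply]
      rw [h, h, hf]))

@[simp]
lemma ι_descRight {W Z : C} (f : ∀ X : C, (dual X ⊗ X) ⊗ W ⟶ Z)
    (hf : ∀ ⦃X Y : C⦄ (g : X ⟶ Y), (dualMap g ▷ X) ▷ W ≫ f X = (dual Y ◁ g) ▷ W ≫ f Y) (X : C) :
    L.ι X ▷ W ≫ L.descRight f hf = f X := by
  rw [descRight, ← tensorRightHomEquiv_symm_naturality, ι_desc, Equiv.symm_apply_apply]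

section

variable [LeftRigidCategory C]

/-- The functor `W ⊗ -` preserves the coend. -/
def descLeft {W Z : C} (f : ∀ X : C, W ⊗ (dual X ⊗ X) ⟶ Z)
    (hf : ∀ ⦃X Y : C⦄ (g : X ⟶ Y), W ◁ (dualMap g ▷ X) ≫ f X = W ◁ (dual Y ◁ g) ≫ f Y) :
    W ⊗ L.obj ⟶ Z :=
  (tensorLeftHomEquiv L.obj (ᘁW : C) W Z).symm
    (L.desc (fun X => tensorLeftHomEquiv (dual X ⊗ X) (ᘁW : C) W Z (f X)) (fun X Y g => by
      have h : ∀ {A B : C} (u : A ⟶ B) (v : W ⊗ B ⟶ Z),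
          u ≫ tensorLeftHomEquiv B (ᘁW : C) W Z v =
            tensorLeftHomEquiv A (ᘁW : C) W Z (W ◁ u ≫ v) := fun u v => by
        rw [← Equiv.symm_apply_eq, tensorLeftHomEquiv_symm_naturality, Equiv.symm_apply_apply]
      rw [h, h, hf]))

@[simp]
lemma ι_descLeft {W Z : C} (f : ∀ X : C, W ⊗ (dual X ⊗ X) ⟶ Z)
    (hf : ∀ ⦃X Y : C⦄ (g : X ⟶ Y), W ◁ (dualMap g ▷ X) ≫ f X = W ◁ (dual Y ◁ g) ≫ f Y) (X : C) :
    W ◁ L.ι X ≫ L.descLeft f hf = f X := by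
  rw [descLeft, ← tensorLeftHomEquiv_symm_naturality, ι_desc, Equiv.symm_apply_apply]

lemma hom_ext_left {W Z : C} {f g : W ⊗ L.obj ⟶ Z} (h : ∀ X, W ◁ L.ι X ≫ f = W ◁ L.ι X ≫ g) :
    f = g := by
  apply (tensorLeftHomEquiv L.obj (ᘁW : C) W Z).injective
  apply L.hom_ext
  intro X
  apply (tensorLeftHomEquiv _ (ᘁW : C) W Z).symm.injective
  rw [tensorLeftHomEquiv_symm_naturality, tensorLeftHomEquiv_symm_naturality,
    Equiv.symm_apply_apply, Equiv.symm_apply_apply, h]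

end

/-- The component of the dinatural family for an arbitrary choice `A` of a right dual of `X`. -/
def ιOf (X A : C) [ExactPairing X A] : A ⊗ X ⟶ L.obj :=
  (rightDualIso (inferInstance : ExactPairing X A) (inferInstance : ExactPairing X (dual X))).hom ▷ X
    ≫ L.ι X

lemma ιOf_dual (X : C) : L.ιOf X (dual X) = L.ι X := by
  simp [ιOf]

lemma rightDualIso_ev (X A : C) [h : ExactPairing X A] :
    (rightDualIso h (inferInstance : ExactPairing X (dual X))).hom ▷ X ≫ ev X = ε_ X A := by
  have := @rightAdjointMate_comp_evaluation C _ _ X X ⟨dual X⟩ ⟨A⟩ (𝟙 X)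
  simpa using! this

lemma eq_of_ev {X B : C} {f g : B ⟶ dual X} (h : f ▷ X ≫ ev X = g ▷ X ≫ ev X) : f = g := by
  have := congrArg (tensorRightHomEquiv B X (dual X) (𝟙_ C)) h
  have h1 := @tensorRightHomEquiv_whiskerRight_comp_evaluation C _ _ X B ⟨dual X⟩ f
  have h2 := @tensorRightHomEquiv_whiskerRight_comp_evaluation C _ _ X B ⟨dual X⟩ g
  exact (cancel_mono _).1 (h1.symm.trans (this.trans h2))

lemma ιOf_condition {X A Y B : C} [ExactPairing X A] [ExactPairing Y B] (g : B ⟶ A) (f : X ⟶ Y)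
    (h : g ▷ X ≫ ε_ X A = B ◁ f ≫ ε_ Y B) :
    g ▷ X ≫ L.ιOf X A = B ◁ f ≫ L.ιOf Y B := by
  have key : g ≫ (rightDualIso (inferInstance : ExactPairing X A)
        (inferInstance : ExactPairing X (dual X))).hom =
      (rightDualIso (inferInstance : ExactPairing Y B)
        (inferInstance : ExactPairing Y (dual Y))).hom ≫ dualMap f := by
    apply eq_of_ev
    rw [comp_whiskerRight, comp_whiskerRight, Category.assoc, Category.assoc, rightDualIso_ev,
      dualMap_ev, ← whisker_exchange_assoc, rightDualIso_ev, h]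
  rw [ιOf, ιOf, whisker_exchange_assoc, ← condition, ← comp_whiskerRight_assoc,
    ← comp_whiskerRight_assoc, key]

lemma hom_ext' {Z : C} (f g : L.obj ⟶ Z) (h : ∀ X, L.ι X ≫ f = L.ι X ≫ g) : f = g :=
  L.hom_ext h

/-- A jointly epimorphic family stays jointly epimorphic after tensoring on the right. -/
lemma whiskerRight_ext {I : Type*} {A : I → C} {B W Z : C} (s : ∀ i, A i ⟶ B)
    (hs : ∀ {T : C} (f g : B ⟶ T), (∀ i, s i ≫ f = s i ≫ g) → f = g) {f g : B ⊗ W ⟶ Z}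
    (h : ∀ i, s i ▷ W ≫ f = s i ▷ W ≫ g) : f = g := by
  apply (tensorRightHomEquiv B W (dual W) Z).injective
  apply hs
  intro i
  apply (tensorRightHomEquiv _ W (dual W) Z).symm.injective
  rw [tensorRightHomEquiv_symm_naturality, tensorRightHomEquiv_symm_naturality,
    Equiv.symm_apply_apply, Equiv.symm_apply_apply, h]

lemma hom_ext₂ [LeftRigidCategory C] {Z : C} (f g : L.obj ⊗ L.obj ⟶ Z)
    (h : ∀ p : C × C, (L.ι p.1 ⊗ₘ L.ι p.2) ≫ f = (L.ι p.1 ⊗ₘ L.ι p.2) ≫ g) : f = g := by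
  apply whiskerRight_ext L.ι L.hom_ext'
  intro X
  apply L.hom_ext_left
  intro Y
  simpa [MonoidalCategory.tensorHom_def'] using h (X, Y)

/-! ### The coalgebra structure -/

/-- The components of the coproduct. -/
def comulApp (X : C) : dual X ⊗ X ⟶ L.obj ⊗ L.obj :=
  dual X ◁ (λ_ X).inv ≫ dual X ◁ coev X ▷ X ⊗≫ (L.ι X ⊗ₘ L.ι X)

lemma comulApp_condition {X Y : C} (g : X ⟶ Y) :
    dualMap g ▷ X ≫ L.comulApp X = dual Y ◁ g ≫ L.comulApp Y := by
  calc
    _ = 𝟙 _ ⊗≫ (dualMap g ▷ 𝟙_ C ≫ dual X ◁ coev X) ▷ X ⊗≫ (dual X ⊗ X) ◁ L.ι X ≫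
          L.ι X ▷ L.obj := by
      rw [comulApp, MonoidalCategory.tensorHom_def']; monoidal
    _ = 𝟙 _ ⊗≫ dual Y ◁ coev X ▷ X ⊗≫ ((dualMap g ▷ X) ▷ (dual X ⊗ X) ≫ (dual X ⊗ X) ◁ L.ι X) ≫
          L.ι X ▷ L.obj := by
      rw [← whisker_exchange]; monoidal
    _ = 𝟙 _ ⊗≫ dual Y ◁ coev X ▷ X ⊗≫ (dual Y ⊗ X) ◁ L.ι X ≫
          (dualMap g ▷ X ≫ L.ι X) ▷ L.obj := by
      rw [← whisker_exchange]; monoidal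
    _ = 𝟙 _ ⊗≫ dual Y ◁ coev X ▷ X ⊗≫ ((dual Y ⊗ X) ◁ L.ι X ≫
          (dual Y ◁ g) ▷ L.obj) ≫ L.ι Y ▷ L.obj := by
      rw [condition]; monoidal
    _ = 𝟙 _ ⊗≫ dual Y ◁ (coev X ≫ g ▷ dual X) ▷ X ⊗≫ (dual Y ⊗ Y) ◁ L.ι X ≫
          L.ι Y ▷ L.obj := by
      rw [whisker_exchange]; monoidal
    _ = 𝟙 _ ⊗≫ dual Y ◁ coev Y ▷ X ⊗≫ (dual Y ⊗ Y) ◁ (dualMap g ▷ X ≫ L.ι X) ≫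
          L.ι Y ▷ L.obj := by
      rw [← coev_dualMap]; monoidal
    _ = 𝟙 _ ⊗≫ dual Y ◁ (coev Y ▷ X ≫ (Y ⊗ dual Y) ◁ g) ⊗≫ (dual Y ⊗ Y) ◁ L.ι Y ≫
          L.ι Y ▷ L.obj := by
      rw [condition]; monoidal
    _ = _ := by
      rw [← whisker_exchange, comulApp, MonoidalCategory.tensorHom_def']; monoidal

/-- The coproduct of `L`. -/
def comul : L.obj ⟶ L.obj ⊗ L.obj :=
  L.desc L.comulApp (fun _ _ g => L.comulApp_condition g)

@[simp]
lemma ι_comul (X : C) : L.ι X ≫ L.comul = L.comulApp X := L.ι_desc _ _ X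

/-- The counit of `L`. -/
def counit : L.obj ⟶ 𝟙_ C := L.desc ev (fun _ _ g => dualMap_ev g)

@[simp]
lemma ι_counit (X : C) : L.ι X ≫ L.counit = ev X := L.ι_desc _ _ X

lemma snake_left (X : C) : dual X ◁ coev X ⊗≫ ev X ▷ dual X = ⊗𝟙.hom :=
  ExactPairing.coevaluation_evaluation'' X (dual X)

lemma snake_right (X : C) : coev X ▷ X ⊗≫ X ◁ ev X = ⊗𝟙.hom :=
  ExactPairing.evaluation_coevaluation'' X (dual X)

instance : ComonObj L.obj where
  counit := L.counit
  comul := L.comul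
  counit_comul := L.hom_ext (fun X => by
    calc
      _ = 𝟙 _ ⊗≫ dual X ◁ coev X ▷ X ⊗≫ (dual X ⊗ X) ◁ L.ι X ≫ (L.ι X ≫ L.counit) ▷ L.obj := by
        rw [reassoc_of% (L.ι_comul X), comulApp, MonoidalCategory.tensorHom_def']; monoidal
      _ = 𝟙 _ ⊗≫ (dual X ◁ coev X ⊗≫ ev X ▷ dual X) ▷ X ⊗≫ L.ι X ⊗≫ 𝟙 _ := by
        rw [ι_counit, whisker_exchange]; monoidal
      _ = _ := by rw [snake_left]; monoidal)
  comul_counit := L.hom_ext (fun X => by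
    calc
      _ = 𝟙 _ ⊗≫ dual X ◁ coev X ▷ X ⊗≫ L.ι X ▷ (dual X ⊗ X) ≫ L.obj ◁ (L.ι X ≫ L.counit) := by
        rw [reassoc_of% (L.ι_comul X), comulApp, MonoidalCategory.tensorHom_def]; monoidal
      _ = 𝟙 _ ⊗≫ dual X ◁ (coev X ▷ X ⊗≫ X ◁ ev X) ⊗≫ L.ι X ⊗≫ 𝟙 _ := by
        rw [ι_counit, ← whisker_exchange]; monoidal
      _ = _ := by rw [snake_right]; monoidal)
  comul_assoc := L.hom_ext (fun X => by
    calc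
      _ = 𝟙 _ ⊗≫ dual X ◁ coev X ▷ X ⊗≫ L.ι X ▷ (dual X ⊗ X) ≫ L.obj ◁ (L.ι X ≫ L.comul) := by
        rw [reassoc_of% (L.ι_comul X), comulApp, MonoidalCategory.tensorHom_def]; monoidal
      _ = 𝟙 _ ⊗≫ dual X ◁ coev X ▷ X ⊗≫ (L.ι X ▷ (dual X ⊗ X) ≫ L.obj ◁ (dual X ◁ (λ_ X).inv ≫
            dual X ◁ coev X ▷ X ⊗≫ L.ι X ▷ (dual X ⊗ X) ≫ L.obj ◁ L.ι X)) := by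
        rw [ι_comul, comulApp, MonoidalCategory.tensorHom_def]
      _ = 𝟙 _ ⊗≫ dual X ◁ coev X ▷ X ⊗≫
            (L.ι X ▷ (dual X ⊗ X) ≫ L.obj ◁ (dual X ◁ (λ_ X).inv ≫ dual X ◁ coev X ▷ X)) ⊗≫
              (L.obj ◁ L.ι X) ▷ (dual X ⊗ X) ⊗≫ (L.obj ⊗ L.obj) ◁ L.ι X ⊗≫ 𝟙 _ := by
        monoidal
      _ = 𝟙 _ ⊗≫ dual X ◁ (coev X ▷ (𝟙_ C) ≫ (X ⊗ dual X) ◁ coev X) ▷ X ⊗≫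
            L.ι X ▷ (dual X ⊗ X) ▷ (dual X ⊗ X) ≫ (L.obj ◁ L.ι X) ▷ (dual X ⊗ X) ⊗≫
              (L.obj ⊗ L.obj) ◁ L.ι X ⊗≫ 𝟙 _ := by
        rw [← whisker_exchange]; monoidal
      _ = 𝟙 _ ⊗≫ dual X ◁ coev X ▷ X ⊗≫ (dual X ◁ coev X ▷ X ⊗≫
            L.ι X ▷ (dual X ⊗ X) ≫ L.obj ◁ L.ι X) ▷ (dual X ⊗ X) ⊗≫
              (L.obj ⊗ L.obj) ◁ L.ι X ⊗≫ 𝟙 _ := by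
        rw [← whisker_exchange]; monoidal
      _ = 𝟙 _ ⊗≫ dual X ◁ coev X ▷ X ⊗≫ (L.ι X ≫ L.comul) ▷ (dual X ⊗ X) ⊗≫
              (L.obj ⊗ L.obj) ◁ L.ι X ⊗≫ 𝟙 _ := by
        rw [ι_comul, comulApp, MonoidalCategory.tensorHom_def]; monoidal
      _ = 𝟙 _ ⊗≫ dual X ◁ coev X ▷ X ⊗≫ L.ι X ▷ (dual X ⊗ X) ⊗≫ (L.comul ▷ (dual X ⊗ X) ≫
              (L.obj ⊗ L.obj) ◁ L.ι X) ⊗≫ 𝟙 _ := by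
        monoidal
      _ = _ := by
        rw [← whisker_exchange, reassoc_of% (L.ι_comul X), comulApp, MonoidalCategory.tensorHom_def]; monoidal)

end CanonicalCoend
end Coend

section Algebra

variable {C : Type u} [Category.{v} C] [MonoidalCategory C]

lemma evaluation_unit : ε_ (𝟙_ C) (𝟙_ C) = (ρ_ (𝟙_ C)).hom := rfl

variable [BraidedCategory C]

/-- The morphism `(A ⊗ X) ⊗ (B ⊗ Y) ⟶ (A ⊗ B) ⊗ (Y ⊗ X)` that braids `X` past `B ⊗ Y`. -/
def mulBraid (A X B Y : C) : (A ⊗ X) ⊗ (B ⊗ Y) ⟶ (A ⊗ B) ⊗ (Y ⊗ X) :=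
  (α_ _ _ _).hom ≫ A ◁ (β_ X (B ⊗ Y)).hom ⊗≫ 𝟙 _

lemma mulBraid_assoc (A X B Y D Z : C) :
    mulBraid A X B Y ▷ (D ⊗ Z) ≫ mulBraid (A ⊗ B) (Y ⊗ X) D Z =
      (α_ _ _ _).hom ≫ (A ⊗ X) ◁ mulBraid B Y D Z ≫ mulBraid A X (B ⊗ D) (Z ⊗ Y) ≫
        (α_ A B D).inv ▷ ((Z ⊗ Y) ⊗ X) ≫ ((A ⊗ B) ⊗ D) ◁ (α_ Z Y X).hom := by
  symm
  calc
    _ = 𝟙 _ ⊗≫ A ◁ (X ◁ mulBraid B Y D Z ≫ (β_ X ((B ⊗ D) ⊗ (Z ⊗ Y))).hom) ⊗≫ 𝟙 _ := by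
      rw [mulBraid.eq_def A]; monoidal
    _ = 𝟙 _ ⊗≫ A ◁ (β_ X (B ⊗ Y)).hom ▷ (D ⊗ Z) ⊗≫ A ◁ (B ⊗ Y) ◁ (β_ X (D ⊗ Z)).hom ⊗≫
          A ◁ mulBraid B Y D Z ▷ X ⊗≫ 𝟙 _ := by
      rw [BraidedCategory.braiding_naturality_right, BraidedCategory.braiding_tensor_right_hom]
      monoidal
    _ = _ := by
      rw [mulBraid, mulBraid, mulBraid, BraidedCategory.braiding_tensor_left_hom Y X]; monoidal

variable [RigidCategory C]

namespace CanonicalCoend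

variable (L : CanonicalCoend C)

/-- The components of the product, for arbitrary right duals `A` of `X` and `B` of `Y`; here
`A ⊗ B` is taken as the right dual of `Y ⊗ X`. -/
def mulOf (X A Y B : C) [ExactPairing X A] [ExactPairing Y B] : (A ⊗ X) ⊗ (B ⊗ Y) ⟶ L.obj :=
  mulBraid A X B Y ≫ L.ιOf (Y ⊗ X) (A ⊗ B)

lemma mulOf_condition_left {X A X' A' : C} (Y B : C) [ExactPairing X A] [ExactPairing X' A']
    [ExactPairing Y B] (g : A' ⟶ A) (f : X ⟶ X') (h : g ▷ X ≫ ε_ X A = A' ◁ f ≫ ε_ X' A') :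
    (g ▷ X) ▷ (B ⊗ Y) ≫ L.mulOf X A Y B = (A' ◁ f) ▷ (B ⊗ Y) ≫ L.mulOf X' A' Y B := by
  have h1 : (g ▷ X) ▷ (B ⊗ Y) ≫ mulBraid A X B Y = mulBraid A' X B Y ≫ (g ▷ B) ▷ (Y ⊗ X) := by
    calc
      _ = 𝟙 _ ⊗≫ (g ▷ (X ⊗ (B ⊗ Y)) ≫ A ◁ (β_ X (B ⊗ Y)).hom) ⊗≫ 𝟙 _ := by
        rw [mulBraid]; monoidal
      _ = _ := by
        rw [← whisker_exchange, mulBraid]; monoidal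
  have h2 : (A' ◁ f) ▷ (B ⊗ Y) ≫ mulBraid A' X' B Y = mulBraid A' X B Y ≫ (A' ⊗ B) ◁ (Y ◁ f) := by
    calc
      _ = 𝟙 _ ⊗≫ A' ◁ (f ▷ (B ⊗ Y) ≫ (β_ X' (B ⊗ Y)).hom) ⊗≫ 𝟙 _ := by
        rw [mulBraid]; monoidal
      _ = _ := by
        rw [BraidedCategory.braiding_naturality_left, mulBraid]; monoidal
  have h3 : (g ▷ B) ▷ (Y ⊗ X) ≫ ε_ (Y ⊗ X) (A ⊗ B) =
      (A' ⊗ B) ◁ (Y ◁ f) ≫ ε_ (Y ⊗ X') (A' ⊗ B) := by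
    rw [ExactPairing.tensor_evaluation, ExactPairing.tensor_evaluation]
    calc
      _ = 𝟙 _ ⊗≫ (g ▷ (B ⊗ Y) ≫ A ◁ ε_ Y B) ▷ X ⊗≫ ε_ X A := by monoidal
      _ = 𝟙 _ ⊗≫ A' ◁ ε_ Y B ▷ X ⊗≫ (g ▷ X ≫ ε_ X A) := by
        rw [← whisker_exchange]; monoidal
      _ = 𝟙 _ ⊗≫ A' ◁ (ε_ Y B ▷ X ≫ 𝟙_ C ◁ f) ⊗≫ ε_ X' A' := by
        rw [h]; monoidal
      _ = _ := by rw [← whisker_exchange]; monoidal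
  rw [mulOf, mulOf, reassoc_of% h1, reassoc_of% h2, ιOf_condition _ _ _ h3]

lemma mulOf_condition_right (X A : C) {Y B Y' B' : C} [ExactPairing X A] [ExactPairing Y B]
    [ExactPairing Y' B'] (g : B' ⟶ B) (f : Y ⟶ Y') (h : g ▷ Y ≫ ε_ Y B = B' ◁ f ≫ ε_ Y' B') :
    (A ⊗ X) ◁ (g ▷ Y) ≫ L.mulOf X A Y B = (A ⊗ X) ◁ (B' ◁ f) ≫ L.mulOf X A Y' B' := by
  have h1 : (A ⊗ X) ◁ (g ▷ Y) ≫ mulBraid A X B Y = mulBraid A X B' Y ≫ (A ◁ g) ▷ (Y ⊗ X) := by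
    calc
      _ = 𝟙 _ ⊗≫ A ◁ (X ◁ (g ▷ Y) ≫ (β_ X (B ⊗ Y)).hom) ⊗≫ 𝟙 _ := by
        rw [mulBraid]; monoidal
      _ = _ := by
        rw [BraidedCategory.braiding_naturality_right, mulBraid]; monoidal
  have h2 : (A ⊗ X) ◁ (B' ◁ f) ≫ mulBraid A X B' Y' =
      mulBraid A X B' Y ≫ (A ⊗ B') ◁ (f ▷ X) := by
    calc
      _ = 𝟙 _ ⊗≫ A ◁ (X ◁ (B' ◁ f) ≫ (β_ X (B' ⊗ Y')).hom) ⊗≫ 𝟙 _ := by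
        rw [mulBraid]; monoidal
      _ = _ := by
        rw [BraidedCategory.braiding_naturality_right, mulBraid]; monoidal
  have h3 : (A ◁ g) ▷ (Y ⊗ X) ≫ ε_ (Y ⊗ X) (A ⊗ B) =
      (A ⊗ B') ◁ (f ▷ X) ≫ ε_ (Y' ⊗ X) (A ⊗ B') := by
    rw [ExactPairing.tensor_evaluation, ExactPairing.tensor_evaluation]
    calc
      _ = 𝟙 _ ⊗≫ A ◁ (g ▷ Y ≫ ε_ Y B) ▷ X ⊗≫ ε_ X A := by monoidal
      _ = _ := by rw [h]; monoidal
  rw [mulOf, mulOf, reassoc_of% h1, reassoc_of% h2, ιOf_condition _ _ _ h3]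

/-- The components of the product; here `x^∨ ⊗ y^∨` is taken as the dual of `y ⊗ x`. -/
def mulApp (X Y : C) : (dual X ⊗ X) ⊗ (dual Y ⊗ Y) ⟶ L.obj :=
  L.mulOf X (dual X) Y (dual Y)

lemma mulApp_condition_left {X X' : C} (Y : C) (g : X ⟶ X') :
    (dualMap g ▷ X) ▷ (dual Y ⊗ Y) ≫ L.mulApp X Y =
      (dual X' ◁ g) ▷ (dual Y ⊗ Y) ≫ L.mulApp X' Y :=
  L.mulOf_condition_left Y (dual Y) (dualMap g) g (dualMap_ev g)

lemma mulApp_condition_right (X : C) {Y Y' : C} (g : Y ⟶ Y') :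
    (dual X ⊗ X) ◁ (dualMap g ▷ Y) ≫ L.mulApp X Y =
      (dual X ⊗ X) ◁ (dual Y' ◁ g) ≫ L.mulApp X Y' :=
  L.mulOf_condition_right X (dual X) (dualMap g) g (dualMap_ev g)

/-- The product of `L`. -/
def mul : L.obj ⊗ L.obj ⟶ L.obj :=
  L.descRight (fun X => L.descLeft (fun Y => L.mulApp X Y)
      (fun _ _ g => L.mulApp_condition_right X g))
    (fun X X' g => L.hom_ext_left (fun Y => by
      rw [whisker_exchange_assoc, whisker_exchange_assoc, ι_descLeft, ι_descLeft,
        mulApp_condition_left]))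

@[simp]
lemma ι_mul (X Y : C) : (L.ι X ⊗ₘ L.ι Y) ≫ L.mul = L.mulApp X Y := by
  rw [MonoidalCategory.tensorHom_def', Category.assoc, mul, ι_descRight, ι_descLeft]

lemma ιOf_mul (X A Y B : C) [ExactPairing X A] [ExactPairing Y B] :
    (L.ιOf X A ⊗ₘ L.ιOf Y B) ≫ L.mul = L.mulOf X A Y B := by
  have h1 := L.mulOf_condition_left Y B
    (rightDualIso (inferInstance : ExactPairing X A) (inferInstance : ExactPairing X (dual X))).hom
    (𝟙 X) (by simpa using! rightDualIso_ev X A)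
  have h2 := L.mulOf_condition_right X (dual X)
    (rightDualIso (inferInstance : ExactPairing Y B) (inferInstance : ExactPairing Y (dual Y))).hom
    (𝟙 Y) (by simpa using! rightDualIso_ev Y B)
  rw [ιOf, ιOf, ← tensorHom_comp_tensorHom, Category.assoc, ι_mul,
    MonoidalCategory.tensorHom_def, Category.assoc, mulApp, h2]
  simpa using h1

/-- The unit of `L`; here the tensor unit is taken as its own dual. -/
def one : 𝟙_ C ⟶ L.obj := (λ_ (𝟙_ C)).inv ≫ L.ιOf (𝟙_ C) (𝟙_ C)

lemma one_mul' : L.one ▷ L.obj ≫ L.mul = (λ_ L.obj).hom := by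
  apply L.hom_ext_left
  intro X
  have h : (λ_ (dual X)).hom ▷ X ≫ L.ιOf X (dual X) =
      (𝟙_ C ⊗ dual X) ◁ (ρ_ X).inv ≫ L.ιOf (X ⊗ 𝟙_ C) (𝟙_ C ⊗ dual X) :=
    L.ιOf_condition _ _ (by
      rw [ExactPairing.tensor_evaluation, evaluation_unit]
      monoidal)
  calc
    _ = (λ_ (𝟙_ C)).inv ▷ (dual X ⊗ X) ≫
          (L.ιOf (𝟙_ C) (𝟙_ C) ⊗ₘ L.ιOf X (dual X)) ≫ L.mul := by
      rw [whisker_exchange_assoc, one, ιOf_dual, MonoidalCategory.tensorHom_def]; monoidal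
    _ = 𝟙 _ ⊗≫ (𝟙_ C ⊗ dual X) ◁ (ρ_ X).inv ≫ L.ιOf (X ⊗ 𝟙_ C) (𝟙_ C ⊗ dual X) := by
      rw [ιOf_mul, mulOf, mulBraid, braiding_tensorUnit_left]; monoidal
    _ = _ := by
      rw [← h, ιOf_dual]; monoidal

lemma mul_one' : L.obj ◁ L.one ≫ L.mul = (ρ_ L.obj).hom := by
  apply whiskerRight_ext L.ι L.hom_ext'
  intro X
  have h : (ρ_ (dual X)).hom ▷ X ≫ L.ιOf X (dual X) =
      (dual X ⊗ 𝟙_ C) ◁ (λ_ X).inv ≫ L.ιOf (𝟙_ C ⊗ X) (dual X ⊗ 𝟙_ C) :=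
    L.ιOf_condition _ _ (by
      rw [ExactPairing.tensor_evaluation, evaluation_unit]
      monoidal)
  have h' : (β_ X (𝟙_ C ⊗ 𝟙_ C)).hom = ⊗𝟙.hom := by
    have := BraidedCategory.braiding_naturality_right X (λ_ (𝟙_ C)).hom
    rw [← cancel_mono ((λ_ (𝟙_ C)).hom ▷ X), ← this, braiding_tensorUnit_right]
    monoidal
  calc
    _ = (dual X ⊗ X) ◁ (λ_ (𝟙_ C)).inv ≫
          (L.ιOf X (dual X) ⊗ₘ L.ιOf (𝟙_ C) (𝟙_ C)) ≫ L.mul := by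
      rw [← whisker_exchange_assoc, one, ιOf_dual, MonoidalCategory.tensorHom_def']; monoidal
    _ = 𝟙 _ ⊗≫ (dual X ⊗ 𝟙_ C) ◁ (λ_ X).inv ≫ L.ιOf (𝟙_ C ⊗ X) (dual X ⊗ 𝟙_ C) := by
      rw [ιOf_mul, mulOf, mulBraid, h']; monoidal
    _ = _ := by
      rw [← h, ιOf_dual]; monoidal

lemma mul_assoc' : L.mul ▷ L.obj ≫ L.mul = (α_ _ _ _).hom ≫ L.obj ◁ L.mul ≫ L.mul := by
  apply L.hom_ext_left
  intro Z
  refine whiskerRight_ext (fun p : C × C => L.ι p.1 ⊗ₘ L.ι p.2) L.hom_ext₂ ?_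
  rintro ⟨X, Y⟩
  dsimp only
  have h : (α_ (dual X) (dual Y) (dual Z)).hom ▷ ((Z ⊗ Y) ⊗ X) ≫
        L.ιOf ((Z ⊗ Y) ⊗ X) (dual X ⊗ (dual Y ⊗ dual Z)) =
      ((dual X ⊗ dual Y) ⊗ dual Z) ◁ (α_ Z Y X).hom ≫
        L.ιOf (Z ⊗ (Y ⊗ X)) ((dual X ⊗ dual Y) ⊗ dual Z) :=
    L.ιOf_condition _ _ (by
      simp only [ExactPairing.tensor_evaluation]
      monoidal)
  calc
    _ = (((L.ι X ⊗ₘ L.ι Y) ≫ L.mul) ⊗ₘ L.ι Z) ≫ L.mul := by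
      rw [MonoidalCategory.tensorHom_def _ (L.ι Z), comp_whiskerRight, Category.assoc,
        Category.assoc, whisker_exchange_assoc]
    _ = mulBraid (dual X) X (dual Y) Y ▷ (dual Z ⊗ Z) ≫
          (L.ιOf (Y ⊗ X) (dual X ⊗ dual Y) ⊗ₘ L.ιOf Z (dual Z)) ≫ L.mul := by
      rw [ι_mul, mulApp, mulOf, ιOf_dual, MonoidalCategory.tensorHom_def,
        MonoidalCategory.tensorHom_def]
      monoidal
    _ = (α_ _ _ _).hom ≫ (dual X ⊗ X) ◁ mulBraid (dual Y) Y (dual Z) Z ≫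
          mulBraid (dual X) X (dual Y ⊗ dual Z) (Z ⊗ Y) ≫
            L.ιOf ((Z ⊗ Y) ⊗ X) (dual X ⊗ (dual Y ⊗ dual Z)) := by
      rw [ιOf_mul, mulOf, ← Category.assoc, mulBraid_assoc]
      simp only [Category.assoc]
      rw [← h]
      simp
    _ = (α_ _ _ _).hom ≫ (L.ι X ⊗ₘ ((L.ι Y ⊗ₘ L.ι Z) ≫ L.mul)) ≫ L.mul := by
      rw [ι_mul, mulApp, mulOf, ← ιOf_dual L X, MonoidalCategory.tensorHom_def',
        MonoidalCategory.whiskerLeft_comp, Category.assoc, Category.assoc,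
        ← MonoidalCategory.tensorHom_def'_assoc, ιOf_mul, mulOf]
    _ = _ := by
      rw [← MonoidalCategory.tensorHom_def_assoc, associator_naturality_assoc]
      simp [MonoidalCategory.tensorHom_def]

instance : MonObj L.obj where
  one := L.one
  mul := L.mul
  one_mul := L.one_mul'
  mul_one := L.mul_one'
  mul_assoc := L.mul_assoc'

/-- The components of the action: the partial monodromy of `x` around `m`. -/
def actionApp (M X : C) : (dual X ⊗ X) ⊗ M ⟶ M :=
  (α_ _ _ _).hom ≫ dual X ◁ ((β_ X M).hom ≫ (β_ M X).hom) ≫ (α_ _ _ _).inv ≫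
    ev X ▷ M ≫ (λ_ M).hom

lemma actionApp_condition (M : C) {X Y : C} (g : X ⟶ Y) :
    (dualMap g ▷ X) ▷ M ≫ actionApp M X = (dual Y ◁ g) ▷ M ≫ actionApp M Y := by
  calc
    _ = 𝟙 _ ⊗≫ (dualMap g ▷ (X ⊗ M) ≫ dual X ◁ ((β_ X M).hom ≫ (β_ M X).hom)) ⊗≫
          ev X ▷ M ⊗≫ 𝟙 _ := by
      rw [actionApp]; monoidal
    _ = 𝟙 _ ⊗≫ dual Y ◁ ((β_ X M).hom ≫ (β_ M X).hom) ⊗≫ (dualMap g ▷ X ≫ ev X) ▷ M ⊗≫ 𝟙 _ := by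
      rw [← whisker_exchange]; monoidal
    _ = 𝟙 _ ⊗≫ dual Y ◁ ((β_ X M).hom ≫ (β_ M X).hom ≫ g ▷ M) ⊗≫ ev Y ▷ M ⊗≫ 𝟙 _ := by
      rw [dualMap_ev]; monoidal
    _ = 𝟙 _ ⊗≫ dual Y ◁ (g ▷ M ≫ (β_ Y M).hom ≫ (β_ M Y).hom) ⊗≫ ev Y ▷ M ⊗≫ 𝟙 _ := by
      rw [← BraidedCategory.braiding_naturality_right,
        ← BraidedCategory.braiding_naturality_left_assoc]
    _ = _ := by
      rw [actionApp]; monoidal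

/-- The canonical action of `L` on an object. -/
def action (M : C) : L.obj ⊗ M ⟶ M :=
  L.descRight (actionApp M) (fun _ _ g => actionApp_condition M g)

variable [RibbonCategory C]

/-- The canonical coaction of `L` on an object; `m` is identified with `m^∨^∨`. -/
def coaction (M : C) : M ⟶ L.obj ⊗ M :=
  (ρ_ M).inv ≫ M ◁ tcoev M ≫ (α_ _ _ _).inv ≫
    (pivotal M ▷ dual M ≫ L.ι (dual M)) ▷ M

end CanonicalCoend

/-- The character of a module `r : A ⊗ m ⟶ m`: the partial trace of the action. -/
def character {A M : C} [RibbonCategory C] (r : A ⊗ M ⟶ M) : A ⟶ 𝟙_ C :=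
  (ρ_ A).inv ≫ A ◁ coev M ≫ (α_ _ _ _).inv ≫ r ▷ dual M ≫ tev M

/-- The cocharacter of a comodule `d : m ⟶ A ⊗ m`: the partial trace of the coaction. -/
def cocharacter {A M : C} [RibbonCategory C] (d : M ⟶ A ⊗ M) : 𝟙_ C ⟶ A :=
  coev M ≫ d ▷ dual M ≫ (α_ _ _ _).hom ≫ A ◁ tev M ≫ (ρ_ A).hom

/-- The character `χ^L_m` of an object, as an element of the convolution ring `Hom(L, 𝟙)`. -/
def CanonicalCoend.chi [RibbonCategory C] (L : CanonicalCoend C) (M : C) : Conv L.obj (𝟙_ C) :=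
  character (L.action M)

/-- The cocharacter of an object, as an element of the convolution ring `Hom(𝟙, L)`. -/
def CanonicalCoend.cochi [RibbonCategory C] (L : CanonicalCoend C) (M : C) : Conv (𝟙_ C) L.obj :=
  cocharacter (L.coaction M)

end Algebra

section Transpose

variable {C : Type u} [Category.{v} C] [MonoidalCategory C] [RightRigidCategory C]

/-- Morphisms `X^∨ ⊗ X ⟶ Z` are the same as morphisms `X ⟶ X ⊗ Z`. -/
def transpose (X Z : C) : (dual X ⊗ X ⟶ Z) ≃ (X ⟶ X ⊗ Z) := tensorLeftHomEquiv X X (dual X) Z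

lemma transpose_comp {X Z Z' : C} (f : dual X ⊗ X ⟶ Z) (h : Z ⟶ Z') :
    transpose X Z' (f ≫ h) = transpose X Z f ≫ X ◁ h :=
  tensorLeftHomEquiv_naturality f h

/-- Under the transposition, dinaturality becomes naturality. -/
lemma dinatural_iff {X Y Z : C} (g : X ⟶ Y) (f : dual X ⊗ X ⟶ Z) (f' : dual Y ⊗ Y ⟶ Z) :
    dualMap g ▷ X ≫ f = dual Y ◁ g ≫ f' ↔ transpose X Z f ≫ g ▷ Z = g ≫ transpose Y Z f' := by
  rw [← (tensorLeftHomEquiv X Y (dual Y) Z).injective.eq_iff]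
  have h1 : tensorLeftHomEquiv X Y (dual Y) Z (dualMap g ▷ X ≫ f) = transpose X Z f ≫ g ▷ Z := by
    calc
      _ = 𝟙 _ ⊗≫ (coev Y ≫ Y ◁ dualMap g) ▷ X ⊗≫ Y ◁ f := by
        change (λ_ _).inv ≫ coev Y ▷ _ ≫ (α_ _ _ _).hom ≫ _ ◁ _ = _
        monoidal
      _ = 𝟙 _ ⊗≫ coev X ▷ X ⊗≫ (g ▷ (dual X ⊗ X) ≫ Y ◁ f) := by
        rw [coev_dualMap]; monoidal
      _ = _ := by
        rw [← whisker_exchange]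
        change _ = ((λ_ _).inv ≫ coev X ▷ _ ≫ (α_ _ _ _).hom ≫ _ ◁ _) ≫ _
        monoidal
  have h2 : tensorLeftHomEquiv X Y (dual Y) Z (dual Y ◁ g ≫ f') = g ≫ transpose Y Z f' := by
    calc
      _ = 𝟙 _ ⊗≫ (coev Y ▷ X ≫ (Y ⊗ dual Y) ◁ g) ⊗≫ Y ◁ f' := by
        change (λ_ _).inv ≫ coev Y ▷ _ ≫ (α_ _ _ _).hom ≫ _ ◁ _ = _
        monoidal
      _ = _ := by
        rw [← whisker_exchange]
        change _ = g ≫ ((λ_ _).inv ≫ coev Y ▷ _ ≫ (α_ _ _ _).hom ≫ _ ◁ _)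
        monoidal
  rw [h1, h2]

/-- An object with a universal dinatural family is a coend. -/
lemma CanonicalCoend.nonempty_of_universal (L : C) (i : ∀ X : C, dual X ⊗ X ⟶ L)
    (hi : ∀ ⦃X Y : C⦄ (g : X ⟶ Y), dualMap g ▷ X ≫ i X = dual Y ◁ g ≫ i Y)
    (h : ∀ {Z : C} (f : ∀ X : C, dual X ⊗ X ⟶ Z),
      (∀ ⦃X Y : C⦄ (g : X ⟶ Y), dualMap g ▷ X ≫ f X = dual Y ◁ g ≫ f Y) →
        ∃! r : L ⟶ Z, ∀ X, i X ≫ r = f X) : Nonempty (CanonicalCoend C) := by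
  have h' : ∀ E : Cowedge (dualTensor C),
      ∃! r : L ⟶ E.pt, ∀ X : C, i X ≫ r = (show dual X ⊗ X ⟶ E.pt from E.π X) :=
    fun E => h (fun X => E.π X) (fun X Y g => Cowedge.condition E g)
  choose r hr hr' using h'
  exact ⟨⟨Cowedge.mk (F := dualTensor C) L i hi, Multicofork.IsColimit.mk _ r hr hr'⟩⟩

end Transpose

section Existence

variable {C : Type u} [Category.{v} C] [Abelian C]

attribute [local instance] Abelian.hasFiniteBiproducts

lemma exists_simple_quotient {Q : C} (h : HasFiniteLength Q) (hQ : ¬ IsZero Q) :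
    ∃ (S : C) (q : Q ⟶ S), Simple S ∧ Epi q := by
  cases h with
  | zero X hX => exact absurd hX hQ
  | extension S hS h₁ h₃ => exact ⟨S.X₃, S.g, h₃, hS.epi_g⟩

/-- A finite category has a projective object `G` such that every object is a quotient of a finite
direct sum of copies of `G`. -/
lemma exists_generator (k : Type w) [Field k] [Linear k C] [IsFiniteCategory k C] :
    ∃ G : C, Projective G ∧ ∀ X : C, ∃ (n : ℕ) (p : Fin n → (G ⟶ X)), Epi (biproduct.desc p) := by
  have := IsFiniteCategory.enough_projectives k (C := C)
  obtain ⟨n, S, hS⟩ := IsFiniteCategory.finite_simples k (C := C)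
  refine ⟨⨁ fun i => Projective.over (S i), ⟨fun f e _ => ⟨biproduct.desc (fun i =>
    Projective.factorThru (biproduct.ι (fun i => Projective.over (S i)) i ≫ f) e), by ext; simp⟩⟩, fun X => ?_⟩
  set G : C := ⨁ fun i => Projective.over (S i) with hG
  have := IsFiniteCategory.finite_hom (k := k) G X
  let b := Module.finBasis k (G ⟶ X)
  refine ⟨_, b, ?_⟩
  set p := biproduct.desc (fun i => b i) with hp
  have hfac : ∀ a : G ⟶ X, a ≫ cokernel.π p = 0 := by
    intro a
    rw [← b.sum_repr a, Preadditive.sum_comp]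
    refine Finset.sum_eq_zero (fun i _ => ?_)
    have : b i = biproduct.ι _ i ≫ p := by simp [hp]
    rw [Linear.smul_comp, this, Category.assoc, cokernel.condition]
    simp
  by_contra hepi
  have hQ : ¬ IsZero (cokernel p) := fun h0 =>
    hepi (Preadditive.epi_of_cokernel_zero (h0.eq_of_tgt _ _))
  obtain ⟨T, q, hT, hq⟩ := exists_simple_quotient (IsFiniteCategory.finite_length k _) hQ
  obtain ⟨i, ⟨e⟩⟩ := hS T hT
  let r : X ⟶ S i := cokernel.π p ≫ q ≫ e.hom
  have : Epi r := inferInstance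
  let c : Projective.over (S i) ⟶ X := Projective.factorThru (Projective.π (S i)) r
  have hc : c ≫ r = Projective.π (S i) := Projective.factorThru_comp _ _
  have h0 : Projective.π (S i) = 0 := by
    have h1 := hfac (biproduct.π _ i ≫ c)
    have h2 : c ≫ cokernel.π p = 0 := by
      rw [← cancel_epi (biproduct.π (fun i => Projective.over (S i)) i)]
      simpa using h1
    rw [← hc]
    simp only [r]
    rw [reassoc_of% h2, zero_comp]
  have : IsZero (S i) := IsZero.of_epi_eq_zero _ h0
  exact Simple.not_isZero T (this.of_iso e)

variable [MonoidalCategory C] [MonoidalPreadditive C]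

/-- An endomorphism-invariant morphism `G ⟶ G ⊗ Z` out of a projective generator extends to a
natural family `X ⟶ X ⊗ Z`. -/
lemma exists_extension {G : C} [Projective G]
    (hG : ∀ X : C, ∃ (n : ℕ) (p : Fin n → (G ⟶ X)), Epi (biproduct.desc p)) {Z : C}
    (t : G ⟶ G ⊗ Z) (ht : ∀ e : G ⟶ G, t ≫ e ▷ Z = e ≫ t) (X : C) :
    ∃ s : X ⟶ X ⊗ Z, ∀ a : G ⟶ X, a ≫ s = t ≫ a ▷ Z := by
  obtain ⟨n, p, hp⟩ := hG X
  have hsep : ∀ {A B : C} (f : A ⟶ B), (∀ a : G ⟶ A, a ≫ f = 0) → f = 0 := by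
    intro A B f h
    obtain ⟨m, q, hq⟩ := hG A
    rw [← cancel_epi (biproduct.desc q)]
    ext i
    simp [h]
  have key : ∀ c : G ⟶ ⨁ (fun _ : Fin n => G),
      c ≫ biproduct.desc (fun i => t ≫ p i ▷ Z) = t ≫ (c ≫ biproduct.desc p) ▷ Z := by
    intro c
    obtain ⟨d, hc⟩ : ∃ d : Fin n → (G ⟶ G),
        c = ∑ i, d i ≫ biproduct.ι (fun _ : Fin n => G) i := by
      refine ⟨fun i => c ≫ biproduct.π _ i, ?_⟩
      calc
        c = c ≫ 𝟙 _ := (Category.comp_id c).symm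
        _ = c ≫ ∑ i, biproduct.π _ i ≫ biproduct.ι (fun _ : Fin n => G) i := by
          rw [biproduct.total]
        _ = _ := by simp only [Preadditive.comp_sum, Category.assoc]
    rw [hc]
    simp only [Preadditive.sum_comp, Category.assoc, biproduct.ι_desc,
      sum_whiskerRight, Preadditive.comp_sum, comp_whiskerRight]
    refine Finset.sum_congr rfl (fun i _ => ?_)
    rw [← reassoc_of% (ht (d i))]
  have hker : kernel.ι (biproduct.desc p) ≫ biproduct.desc (fun i => t ≫ p i ▷ Z) = 0 := by
    apply hsep
    intro a
    rw [← Category.assoc, key, Category.assoc, kernel.condition]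
    simp
  refine ⟨Abelian.epiDesc (biproduct.desc p) _ hker, fun a => ?_⟩
  rw [← Projective.factorThru_comp a (biproduct.desc p), Category.assoc, Abelian.comp_epiDesc, key]

variable [RigidCategory C]

/-- In a finite tensor category the coend `∫^x x^∨ ⊗ x` exists. -/
theorem exists_coend (k : Type w) [Field k] [Linear k C] [MonoidalLinear k C]
    [IsFiniteCategory k C] : Nonempty (CanonicalCoend C) := by
  obtain ⟨G, hP, hG⟩ := exists_generator k (C := C)
  have hsep : ∀ {A B : C} (f f' : A ⟶ B), (∀ a : G ⟶ A, a ≫ f = a ≫ f') → f = f' := by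
    intro A B f f' h
    obtain ⟨m, q, hq⟩ := hG A
    rw [← cancel_epi (biproduct.desc q)]
    ext i
    simp [h]
  have := IsFiniteCategory.finite_hom (k := k) G G
  let b := Module.finBasis k (G ⟶ G)
  -- the quotient of `G^∨ ⊗ G` by the action of the endomorphisms of `G`
  let d := biproduct.desc (fun i => dualMap (b i) ▷ G - dual G ◁ b i)
  let π := cokernel.π d
  let t := transpose G (cokernel d) π
  have ht_of : ∀ {Z : C} (t : G ⟶ G ⊗ Z), (∀ i, t ≫ b i ▷ Z = b i ≫ t) →
      ∀ e : G ⟶ G, t ≫ e ▷ Z = e ≫ t := by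
    intro Z t h e
    rw [← b.sum_repr e, Preadditive.sum_comp, sum_whiskerRight, Preadditive.comp_sum]
    refine Finset.sum_congr rfl (fun i _ => ?_)
    rw [MonoidalLinear.smul_whiskerRight, Linear.comp_smul, Linear.smul_comp, h]
  have ht : ∀ e : G ⟶ G, t ≫ e ▷ _ = e ≫ t := by
    refine ht_of t (fun i => ?_)
    rw [← dinatural_iff, ← sub_eq_zero, ← Preadditive.sub_comp]
    have : dualMap (b i) ▷ G - dual G ◁ b i = biproduct.ι _ i ≫ d := by simp [d]
    rw [this, Category.assoc, cokernel.condition, comp_zero]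
  choose s hs using exists_extension hG t ht
  have hsG : s G = t := by simpa using hs G (𝟙 G)
  have hnat : ∀ {X Y : C} (g : X ⟶ Y), s X ≫ g ▷ _ = g ≫ s Y := by
    intro X Y g
    apply hsep
    intro a
    rw [← Category.assoc, hs, ← Category.assoc a g, hs, comp_whiskerRight, Category.assoc]
  have hπ : (transpose G _).symm (s G) = π := by rw [hsG]; simp [t]
  refine CanonicalCoend.nonempty_of_universal (cokernel d) (fun X => (transpose X _).symm (s X))
    (fun X Y g => (dinatural_iff g _ _).2 (by simpa using hnat g)) (fun {Z} f hf => ?_)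
  have hd : d ≫ f G = 0 := by
    apply biproduct.hom_ext'
    intro i
    rw [biproduct.ι_desc_assoc, Preadditive.sub_comp, hf (b i), sub_self, comp_zero]
  refine ⟨cokernel.desc d (f G) hd, fun X => ?_, fun m hm => ?_⟩
  · apply (transpose X _).injective
    rw [transpose_comp, Equiv.apply_symm_apply]
    apply hsep
    intro a
    have hG' : t ≫ G ◁ cokernel.desc d (f G) hd = transpose G Z (f G) := by
      rw [← transpose_comp, cokernel.π_desc]
    have hcond := (dinatural_iff a (f G) (f X)).1 (hf a)
    rw [← Category.assoc, hs, Category.assoc, ← whisker_exchange, ← Category.assoc, hG', hcond]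
  · rw [← cancel_epi (cokernel.π d), cokernel.π_desc, ← hm G, hπ]

end Existence

end FiniteRibbon

end

attribute [local instance] CategoryTheory.MonObj.instTensorUnit
attribute [local instance] CategoryTheory.ComonObj.instTensorUnit

/-! Existence of the coend is `exists_coend`; the substance is that characters and cocharacters are
additive, multiplicative and unital on objects, after which `K0.liftRingHom` applies.

A form on `L` is determined by its composites with the family `ι`. For the character of `m`, the
composite with `ι x` is `ev x` preceded by an endomorphism `link m x` of `x`: a closed `m`-strand
encircling `x` (`ι_character`). For forms given in this way by endomorphisms `F` and `G`,
convolution amounts to the composition `F ∘ G`, by a zigzag identity (`ι_comul_forms`). Two parallel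
loops can be drawn as two successive loops, by the hexagon identities and naturality of the braiding
(`link_tensor`).

For the cocharacter, the coevaluation in `δ` and the left evaluation in the trace cancel in a
zigzag, leaving `coev m` followed by the component of the dinatural family at `m^∨`, with `m` as its
right dual (`cocharacter_coaction`). In a product, the braiding in `μ` is applied to a strand next
to `coev n`. By naturality it disappears, and what remains is the coevaluation of `m ⊗ n`.

Additivity cannot use splittings. It rests on `trace_shortExact`: after composition with an
epimorphism onto the unit, `coev X₂` becomes a sum of two terms, and a dinatural trace sends these
to the contributions of `X₁` and `X₃`.

Duals of tensor products and of the unit are not the chosen ones on the nose, so traces and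
components are defined for arbitrary right duals and shown to be independent of that choice
(`linkOf_eq`, `coev_ιOf`). -/

noncomputable section

namespace FiniteRibbon

/-! ### Ring homomorphisms out of the Grothendieck ring -/

section GrothendieckRingHom

variable {C : Type u} [Category.{v} C] [Abelian C] [MonoidalCategory C] [MonoidalPreadditive C]
  [RigidCategory C]

/-- An additive and multiplicative function on objects induces a ring homomorphism on the
Grothendieck ring. -/
def K0.liftRingHom {R : Type*} [Ring R] (f : C → R)
    (hf : ∀ S : ShortComplex C, S.ShortExact → f S.X₂ = f S.X₁ + f S.X₃)
    (h_one : f (𝟙_ C) = 1) (h_mul : ∀ X Y, f (X ⊗ Y) = f X * f Y) : K0 C →+* R where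
  __ := K0.lift f hf
  map_one' := (K0.lift_mk f hf (𝟙_ C)).trans h_one
  map_zero' := map_zero (K0.lift f hf)
  map_add' := map_add (K0.lift f hf)
  map_mul' a b := by
    -- Both sides of multiplicativity are biadditive, so as maps into additive homomorphisms they
    -- need only be compared on classes of objects.
    have h : K0.mulHom.compr₂ (K0.lift f hf) =
        (AddMonoidHom.mul.compl₂ (K0.lift f hf)).comp (K0.lift f hf) :=
      K0.hom_ext (fun X => K0.hom_ext (fun Y => by
        simpa [← K0.mul_def] using h_mul X Y))
    exact DFunLike.congr_fun (DFunLike.congr_fun h a) b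

end GrothendieckRingHom

/-! ### Comparison of right duals, and convolution of forms on the coend -/

section Duality

variable {C : Type u} [Category.{v} C] [MonoidalCategory C] [RightRigidCategory C]

/-- The comparison of an arbitrary right dual with the chosen one. -/
def dualIso (X A : C) [h : ExactPairing X A] : A ≅ dual X :=
  rightDualIso h (inferInstance : ExactPairing X (dual X))

lemma dualIso_ev (X A : C) [ExactPairing X A] : (dualIso X A).hom ▷ X ≫ ev X = ε_ X A :=
  CanonicalCoend.rightDualIso_ev X A

lemma coev_dualIso (X A : C) [h : ExactPairing X A] :
    η_ X A ≫ X ◁ (dualIso X A).hom = coev X := by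
  have := @coevaluation_comp_rightAdjointMate C _ _ X X ⟨dual X⟩ ⟨A⟩ (𝟙 X)
  simpa using! this

lemma dualMap_comp {X Y Z : C} (f : X ⟶ Y) (g : Y ⟶ Z) :
    dualMap (f ≫ g) = dualMap g ≫ dualMap f :=
  comp_rightAdjointMate

namespace CanonicalCoend

variable (L : CanonicalCoend C)

/-- The convolution product of forms that are given by endomorphisms. -/
lemma ι_comul_forms {f g : L.obj ⟶ 𝟙_ C} {X : C} {F G : X ⟶ X}
    (hf : L.ι X ≫ f = dual X ◁ F ≫ ev X) (hg : L.ι X ≫ g = dual X ◁ G ≫ ev X) :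
    L.ι X ≫ L.comul ≫ f ▷ L.obj ≫ 𝟙_ C ◁ g ≫ (λ_ (𝟙_ C)).hom = dual X ◁ (G ≫ F) ≫ ev X := by
  calc
    _ = 𝟙 _ ⊗≫ dual X ◁ coev X ▷ X ⊗≫ L.ι X ▷ (dual X ⊗ X) ≫ (L.obj ◁ L.ι X ≫ f ▷ L.obj) ≫
          𝟙_ C ◁ g ⊗≫ 𝟙 _ := by
      rw [reassoc_of% (L.ι_comul X), comulApp, MonoidalCategory.tensorHom_def]; monoidal
    _ = 𝟙 _ ⊗≫ dual X ◁ coev X ▷ X ⊗≫ (L.ι X ≫ f) ▷ (dual X ⊗ X) ⊗≫ (L.ι X ≫ g) := by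
      rw [whisker_exchange]; monoidal
    _ = 𝟙 _ ⊗≫ dual X ◁ (coev X ▷ X ≫ F ▷ dual X ▷ X) ⊗≫
          (ev X ▷ (dual X ⊗ X) ≫ 𝟙_ C ◁ (dual X ◁ G ≫ ev X)) ⊗≫ 𝟙 _ := by
      rw [hf, hg]; monoidal
    _ = 𝟙 _ ⊗≫ dual X ◁ (coev X ▷ X ⊗≫
          (F ▷ (dual X ⊗ X) ≫ X ◁ (dual X ◁ G ≫ ev X))) ⊗≫ ev X := by
      rw [← whisker_exchange]; monoidal
    _ = 𝟙 _ ⊗≫ dual X ◁ ((coev X ▷ X ≫ (X ⊗ dual X) ◁ G) ⊗≫ X ◁ ev X ⊗≫ F) ⊗≫ ev X := by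
      rw [← whisker_exchange]; monoidal
    _ = 𝟙 _ ⊗≫ dual X ◁ (G ≫ (𝟙 _ ⊗≫ (coev X ▷ X ⊗≫ X ◁ ev X) ⊗≫ F)) ⊗≫ ev X := by
      rw [← whisker_exchange]; monoidal
    _ = _ := by
      rw [snake_right]; monoidal

end CanonicalCoend

end Duality

/-! ### The left duality given by the twist, and its compatibility with tensor products -/

section RibbonDuality

variable {C : Type u} [Category.{v} C] [MonoidalCategory C] [BraidedCategory C]
  [RigidCategory C] [RibbonCategory C]

/-- The twist as an isomorphism. -/
def twistIso (X : C) : X ≅ X := (RibbonCategory.twist (C := C)).app X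

@[simp]
lemma twistIso_hom (X : C) : (twistIso X).hom = twist X := rfl

lemma twist_naturality {X Y : C} (f : X ⟶ Y) : f ≫ twist Y = twist X ≫ f :=
  (RibbonCategory.twist (C := C)).hom.naturality f

lemma twist_tensor (X Y : C) :
    twist (X ⊗ Y) = (twist X ⊗ₘ twist Y) ≫ (β_ X Y).hom ≫ (β_ Y X).hom :=
  RibbonCategory.twist_tensor X Y

lemma twist_dual (X : C) : twist (dual X) = dualMap (twist X) :=
  RibbonCategory.twist_dual X

-- The monodromy of the unit with itself is trivial, so balancing and naturality along `λ_` make the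
-- twist of the unit idempotent. Being invertible, it is the identity.
@[simp]
lemma twist_unit : twist (𝟙_ C) = 𝟙 (𝟙_ C) := by
  have h1 := twist_tensor (𝟙_ C) (𝟙_ C)
  have h2 := twist_naturality (λ_ (𝟙_ C)).hom
  have h3 : (twist (𝟙_ C) ⊗ₘ twist (𝟙_ C)) ≫ (λ_ (𝟙_ C)).hom =
      (λ_ (𝟙_ C)).hom ≫ twist (𝟙_ C) ≫ twist (𝟙_ C) := by
    rw [MonoidalCategory.tensorHom_def, Category.assoc, leftUnitor_naturality, unitors_equal,
      rightUnitor_naturality_assoc]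
  have h4 : twist (𝟙_ C ⊗ 𝟙_ C) = twist (𝟙_ C) ⊗ₘ twist (𝟙_ C) := by
    rw [h1, braiding_tensorUnit_right, ← unitors_equal]
    simp
  rw [h4, h3, cancel_epi] at h2
  have : Epi (twist (𝟙_ C)) := inferInstanceAs (Epi (twistIso (𝟙_ C)).hom)
  rw [← cancel_epi (twist (𝟙_ C)), ← h2, Category.comp_id]

/-- The left coevaluation in terms of the inverse of the twist and of the braiding. -/
lemma tcoev_eq (X : C) :
    tcoev X = (coev X ≫ (β_ (dual X) X).inv) ≫ dual X ◁ (twistIso X).inv := by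
  -- Balancing expands this twist into a monodromy and twists on both factors. `twist_dual` moves
  -- the twist of the dual across `coev`, so the twist of `X` occurs twice; cancelling one twist and
  -- one braiding gives the claim.
  have h1 : coev X ≫ twist (X ⊗ dual X) = coev X := by
    rw [twist_naturality, twist_unit, Category.id_comp]
  rw [twist_tensor, MonoidalCategory.tensorHom_def', Category.assoc, twist_dual,
    reassoc_of% (coev_dualMap (twist X)), BraidedCategory.braiding_naturality_left_assoc,
    BraidedCategory.braiding_naturality_left_assoc] at h1
  rw [tcoev, ← cancel_mono (dual X ◁ (twistIso X).hom), ← cancel_mono (β_ (dual X) X).hom]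
  have h2 : (twistIso X).inv ▷ dual X ≫ twist X ▷ dual X = 𝟙 _ := by
    rw [← comp_whiskerRight, ← twistIso_hom, Iso.inv_hom_id, id_whiskerRight]
  simpa [h2] using h1

/-- The left duality of a ribbon category: `x` is a right dual of `x^∨`. -/
@[reducible]
def leftPairing (X : C) : ExactPairing (dual X) X :=
  letI := BraidedCategory.exactPairing_swap X (dual X)
  exactPairingCongrRight (twistIso X)

/-- The evaluation of `leftPairing` is `tev` by definition. With this, the zigzag identities hold
for the pair `tev`, `tcoev`. -/
lemma leftPairing_coevaluation (X : C) :
    (leftPairing X).coevaluation' = tcoev X := (tcoev_eq X).symm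

/-- This compatibility lets a trace pass along the maps of a short exact sequence. -/
lemma tev_dinatural {X Y : C} (f : X ⟶ Y) :
    X ◁ dualMap f ≫ tev X = f ▷ dual Y ≫ tev Y := by
  rw [tev, tev, whisker_exchange_assoc, BraidedCategory.braiding_naturality_right_assoc, dualMap_ev,
    ← BraidedCategory.braiding_naturality_left_assoc, ← comp_whiskerRight_assoc,
    ← comp_whiskerRight_assoc, twist_naturality]

/-- The left evaluation for an arbitrary right dual. -/
def tevOf (X A : C) [ExactPairing X A] : X ⊗ A ⟶ 𝟙_ C :=
  twist X ▷ A ≫ (β_ X A).hom ≫ ε_ X A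

lemma tevOf_dual (X : C) : tevOf X (dual X) = tev X := rfl

lemma dualIso_tev (X A : C) [ExactPairing X A] :
    X ◁ (dualIso X A).hom ≫ tev X = tevOf X A := by
  rw [tev, tevOf, whisker_exchange_assoc, BraidedCategory.braiding_naturality_right_assoc,
    dualIso_ev]

lemma tevOf_unit : tevOf (𝟙_ C) (𝟙_ C) = (ρ_ (𝟙_ C)).hom := by
  rw [tevOf, evaluation_unit, twist_unit, braiding_tensorUnit_right, ← unitors_equal]
  simp

/-- The twist of `X ⊗ Y` contributes two crossings between `X` and `Y`. Each is absorbed when a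
strand is pulled past an evaluation, so only the nested evaluations remain. -/
lemma tevOf_tensor (X A Y B : C) [ExactPairing X A] [ExactPairing Y B] :
    tevOf (X ⊗ Y) (B ⊗ A) = 𝟙 _ ⊗≫ X ◁ tevOf Y B ▷ A ⊗≫ tevOf X A := by
  have slide : (β_ Y A).hom ▷ X ⊗≫ A ◁ (β_ Y X).hom ⊗≫ ε_ X A ▷ Y =
      𝟙 _ ⊗≫ Y ◁ ε_ X A ⊗≫ 𝟙 _ := by
    have := BraidedCategory.braiding_naturality_right Y (ε_ X A)
    rw [BraidedCategory.braiding_tensor_right_hom, braiding_tensorUnit_right] at this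
    calc
      _ = 𝟙 _ ⊗≫ (((α_ Y A X).inv ≫ (β_ Y A).hom ▷ X ≫ (α_ A Y X).hom ≫ A ◁ (β_ Y X).hom ≫
            (α_ A X Y).inv) ≫ ε_ X A ▷ Y) := by monoidal
      _ = _ := by rw [← this]; monoidal
  have cross : (β_ X Y).hom ▷ B ⊗≫ Y ◁ (β_ X B).hom ⊗≫ ((β_ Y B).hom ≫ ε_ Y B) ▷ X =
      𝟙 _ ⊗≫ X ◁ ((β_ Y B).hom ≫ ε_ Y B) ⊗≫ 𝟙 _ := by
    have := BraidedCategory.braiding_naturality_right X ((β_ Y B).hom ≫ ε_ Y B)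
    rw [BraidedCategory.braiding_tensor_right_hom, braiding_tensorUnit_right] at this
    calc
      _ = 𝟙 _ ⊗≫ (((α_ X Y B).inv ≫ (β_ X Y).hom ▷ B ≫ (α_ Y X B).hom ≫ Y ◁ (β_ X B).hom ≫
            (α_ Y B X).inv) ≫ ((β_ Y B).hom ≫ ε_ Y B) ▷ X) := by monoidal
      _ = _ := by rw [← this]; monoidal
  calc
    _ = (twist X ⊗ₘ twist Y) ▷ (B ⊗ A) ≫ (β_ X Y).hom ▷ (B ⊗ A) ≫
          (β_ (Y ⊗ X) (B ⊗ A)).hom ≫ (B ⊗ A) ◁ (β_ Y X).hom ≫ ε_ (X ⊗ Y) (B ⊗ A) := by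
      rw [tevOf, twist_tensor, ← BraidedCategory.braiding_naturality_left_assoc (β_ Y X).hom (B ⊗ A)]
      simp only [comp_whiskerRight, Category.assoc]
    _ = (twist X ⊗ₘ twist Y) ▷ (B ⊗ A) ⊗≫ (β_ X Y).hom ▷ B ▷ A ⊗≫
          Y ◁ (β_ X B).hom ▷ A ⊗≫ (Y ⊗ B) ◁ (β_ X A).hom ⊗≫ (β_ Y B).hom ▷ (A ⊗ X) ⊗≫
          B ◁ ((β_ Y A).hom ▷ X ⊗≫ A ◁ (β_ Y X).hom ⊗≫ ε_ X A ▷ Y) ⊗≫ ε_ Y B := by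
      rw [BraidedCategory.braiding_tensor_left_hom, BraidedCategory.braiding_tensor_right_hom,
        BraidedCategory.braiding_tensor_right_hom, ExactPairing.tensor_evaluation]
      monoidal
    _ = (twist X ⊗ₘ twist Y) ▷ (B ⊗ A) ⊗≫ (β_ X Y).hom ▷ B ▷ A ⊗≫
          Y ◁ (β_ X B).hom ▷ A ⊗≫ (Y ⊗ B) ◁ (β_ X A).hom ⊗≫ ((β_ Y B).hom ▷ (A ⊗ X) ≫
          (B ⊗ Y) ◁ ε_ X A) ⊗≫ ε_ Y B := by
      rw [slide]; monoidal
    _ = (twist X ⊗ₘ twist Y) ▷ (B ⊗ A) ⊗≫ (β_ X Y).hom ▷ B ▷ A ⊗≫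
          Y ◁ (β_ X B).hom ▷ A ⊗≫ (Y ⊗ B) ◁ ((β_ X A).hom ≫ ε_ X A) ⊗≫
          (β_ Y B).hom ≫ ε_ Y B := by
      rw [← whisker_exchange]; monoidal
    _ = (twist X ⊗ₘ twist Y) ▷ (B ⊗ A) ⊗≫ (β_ X Y).hom ▷ B ▷ A ⊗≫
          Y ◁ (β_ X B).hom ▷ A ⊗≫ ((Y ⊗ B) ◁ ((β_ X A).hom ≫ ε_ X A) ≫
          ((β_ Y B).hom ≫ ε_ Y B) ▷ 𝟙_ C) ⊗≫ 𝟙 _ := by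
      monoidal
    _ = (twist X ⊗ₘ twist Y) ▷ (B ⊗ A) ⊗≫ ((β_ X Y).hom ▷ B ⊗≫
          Y ◁ (β_ X B).hom ⊗≫ ((β_ Y B).hom ≫ ε_ Y B) ▷ X) ▷ A ⊗≫
          (β_ X A).hom ≫ ε_ X A := by
      rw [whisker_exchange]; monoidal
    _ = 𝟙 _ ⊗≫ (X ◁ twist Y ≫ twist X ▷ Y) ▷ (B ⊗ A) ⊗≫ X ◁ ((β_ Y B).hom ≫ ε_ Y B) ▷ A ⊗≫
          (β_ X A).hom ≫ ε_ X A := by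
      rw [cross, MonoidalCategory.tensorHom_def']; monoidal
    _ = 𝟙 _ ⊗≫ (X ◁ twist Y) ▷ (B ⊗ A) ⊗≫ (twist X ▷ (Y ⊗ B) ≫ X ◁ ((β_ Y B).hom ≫ ε_ Y B)) ▷ A ⊗≫
          (β_ X A).hom ≫ ε_ X A := by
      monoidal
    _ = _ := by
      rw [← whisker_exchange, tevOf, tevOf]; monoidal

end RibbonDuality

/-! ### Additivity of partial traces on short exact sequences -/

section TraceAdditivity

variable {C : Type u} [Category.{v} C] [Abelian C] [MonoidalCategory C] [MonoidalPreadditive C]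
  [RigidCategory C]

lemma dualMap_zero (X Y : C) : dualMap (0 : X ⟶ Y) = 0 := by
  apply CanonicalCoend.eq_of_ev
  rw [dualMap_ev]
  simp

/-- Partial traces are additive on short exact sequences. The trace of an object `X` is given by
a morphism `t` out of `A ⊗ (X ⊗ X^∨)`, and the morphisms `t` have to be compatible with the maps
of the sequence. -/
lemma trace_shortExact {S : ShortComplex C} (hS : S.ShortExact) {A B : C}
    (t₁ : A ⊗ S.X₁ ⊗ dual S.X₁ ⟶ B) (t₂ : A ⊗ S.X₂ ⊗ dual S.X₂ ⟶ B)
    (t₃ : A ⊗ S.X₃ ⊗ dual S.X₃ ⟶ B)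
    (hf : A ◁ S.f ▷ dual S.X₂ ≫ t₂ = A ◁ S.X₁ ◁ dualMap S.f ≫ t₁)
    (hg : A ◁ S.g ▷ dual S.X₃ ≫ t₃ = A ◁ S.X₂ ◁ dualMap S.g ≫ t₂) :
    A ◁ coev S.X₂ ≫ t₂ = A ◁ coev S.X₁ ≫ t₁ + A ◁ coev S.X₃ ≫ t₃ := by
  have : Epi (S.g ▷ dual S.X₃) := (K0.shortExact_tensorRight (dual S.X₃) hS).epi_g
  have : Mono (S.f ▷ dual S.X₁) := (K0.shortExact_tensorRight (dual S.X₁) hS).mono_f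
  have hE := K0.shortExact_tensorRight (dual S.X₂) hS
  have := hE.mono_f
  -- The unit need not be projective, so `coev S.X₃` is lifted to `S.X₂ ⊗ dual S.X₃` only after an
  -- epimorphism `π` onto the unit.
  obtain ⟨E, π, _, v, hv⟩ := surjective_up_to_refinements_of_epi (S.g ▷ dual S.X₃) (coev S.X₃)
  -- Both terms become `coev S.X₃` followed by the dual of `S.g`; hence their difference factors
  -- through `S.X₁ ⊗ dual S.X₂`.
  have hw : (π ≫ coev S.X₂ - v ≫ S.X₂ ◁ dualMap S.g) ≫ S.g ▷ dual S.X₂ = 0 := by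
    rw [Preadditive.sub_comp, sub_eq_zero, Category.assoc, ← coev_dualMap, Category.assoc,
      whisker_exchange, reassoc_of% hv]
  let u : E ⟶ S.X₁ ⊗ dual S.X₂ := hE.exact.lift _ hw
  have hu : u ≫ S.f ▷ dual S.X₂ = π ≫ coev S.X₂ - v ≫ S.X₂ ◁ dualMap S.g :=
    hE.exact.lift_f _ hw
  -- Tested against the monomorphism `S.f ▷ dual S.X₁`: the `v` term dies because the duals of `S.g`
  -- and `S.f` compose to zero.
  have hu₁ : u ≫ S.X₁ ◁ dualMap S.f = π ≫ coev S.X₁ := by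
    rw [← cancel_mono (S.f ▷ dual S.X₁), Category.assoc, Category.assoc, ← coev_dualMap,
      whisker_exchange, reassoc_of% hu, Preadditive.sub_comp, Category.assoc, Category.assoc,
      ← MonoidalCategory.whiskerLeft_comp, ← dualMap_comp, S.zero, dualMap_zero]
    simp
  -- Tensoring with `A` is a left adjoint, so the refinement can be cancelled at the end.
  have : Epi (A ◁ π) := by
    have := (tensorLeftAdjunction (ᘁA) A).leftAdjoint_preservesColimits
    exact inferInstanceAs (Epi ((tensorLeft A).map π))
  have h₂ : π ≫ coev S.X₂ = u ≫ S.f ▷ dual S.X₂ + v ≫ S.X₂ ◁ dualMap S.g := by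
    rw [hu, sub_add_cancel]
  rw [← cancel_epi (A ◁ π), Preadditive.comp_add, ← MonoidalCategory.whiskerLeft_comp_assoc,
    ← MonoidalCategory.whiskerLeft_comp_assoc, ← MonoidalCategory.whiskerLeft_comp_assoc, h₂,
    ← hu₁, hv, MonoidalPreadditive.whiskerLeft_add, Preadditive.add_comp]
  simp only [MonoidalCategory.whiskerLeft_comp, Category.assoc, hf, hg]

end TraceAdditivity

/-! ### Characters as encircling loops -/

section Character

variable {C : Type u} [Category.{v} C] [MonoidalCategory C] [BraidedCategory C]
  [RigidCategory C] [RibbonCategory C]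

/-- The partial trace over `m` of the double braiding of `x` and `m`, computed with an arbitrary
right dual `A` of `m`. -/
def linkOf (M A X : C) [ExactPairing M A] : X ⟶ X :=
  𝟙 _ ⊗≫ X ◁ η_ M A ⊗≫ ((β_ X M).hom ≫ (β_ M X).hom) ▷ A ⊗≫ X ◁ tevOf M A ⊗≫ 𝟙 _

/-- The partial trace over `m` of the double braiding of `x` and `m`. -/
def link (M X : C) : X ⟶ X := linkOf M (dual M) X

lemma link_def (M X : C) : link M X =
    𝟙 _ ⊗≫ X ◁ coev M ⊗≫ ((β_ X M).hom ≫ (β_ M X).hom) ▷ dual M ⊗≫ X ◁ tev M ⊗≫ 𝟙 _ := rfl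

lemma linkOf_eq (M A X : C) [ExactPairing M A] : linkOf M A X = link M X := by
  rw [link_def, ← coev_dualIso M A, linkOf, ← dualIso_tev]
  calc
    _ = 𝟙 _ ⊗≫ X ◁ η_ M A ⊗≫ (((β_ X M).hom ≫ (β_ M X).hom) ▷ A ≫
          (X ⊗ M) ◁ (dualIso M A).hom) ⊗≫ X ◁ tev M ⊗≫ 𝟙 _ := by monoidal
    _ = _ := by
      rw [← whisker_exchange]; monoidal

lemma link_unit (X : C) : link (𝟙_ C) X = 𝟙 X := by
  rw [← linkOf_eq (𝟙_ C) (𝟙_ C), linkOf, tevOf_unit, braiding_tensorUnit_left,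
    braiding_tensorUnit_right]
  change 𝟙 _ ⊗≫ X ◁ (ρ_ (𝟙_ C)).inv ⊗≫ _ = _
  monoidal

/-- With `dual N ⊗ dual M` as dual of `M ⊗ N`, the `N`-loop is nested inside the `M`-loop. It closes
up to `link N X` between the two crossings of `X` with `M`, and naturality of the braiding slides it
out along `X`. -/
lemma link_tensor (M N X : C) : link (M ⊗ N) X = link N X ≫ link M X := by
  rw [← linkOf_eq (M ⊗ N) (dual N ⊗ dual M)]
  calc
    _ = 𝟙 _ ⊗≫ X ◁ coev M ⊗≫
          ((X ⊗ M) ◁ coev N ≫ (β_ X M).hom ▷ (N ⊗ dual N)) ▷ dual M ⊗≫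
          M ◁ ((β_ X N).hom ≫ (β_ N X).hom) ▷ dual N ▷ dual M ⊗≫
          ((β_ M X).hom ▷ (N ⊗ dual N) ≫ (X ⊗ M) ◁ tev N) ▷ dual M ⊗≫ X ◁ tev M ⊗≫ 𝟙 _ := by
      rw [linkOf, tevOf_tensor, ExactPairing.tensor_coevaluation,
        BraidedCategory.braiding_tensor_left_hom, BraidedCategory.braiding_tensor_right_hom,
        tevOf_dual, tevOf_dual]
      change 𝟙 _ ⊗≫ X ◁ (coev M ⊗≫ (M ◁ coev N) ▷ _ ⊗≫ _) ⊗≫ _ = _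
      monoidal
    _ = 𝟙 _ ⊗≫ X ◁ coev M ⊗≫ ((β_ X M).hom ≫ M ◁ link N X ≫ (β_ M X).hom) ▷ dual M ⊗≫
          X ◁ tev M ⊗≫ 𝟙 _ := by
      rw [whisker_exchange, ← whisker_exchange (β_ M X).hom, link_def]; monoidal
    _ = 𝟙 _ ⊗≫ (X ◁ coev M ≫ link N X ▷ (M ⊗ dual M)) ⊗≫
          ((β_ X M).hom ≫ (β_ M X).hom) ▷ dual M ⊗≫ X ◁ tev M ⊗≫ 𝟙 _ := by
      rw [← BraidedCategory.braiding_naturality_left_assoc]; monoidal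
    _ = _ := by
      rw [whisker_exchange, link_def M]; monoidal

namespace CanonicalCoend

variable (L : CanonicalCoend C)

/-- The action pairs the `X`-strand with its dual only after the monodromy with `M`, so the trace
over `M` can be closed before that pairing. -/
lemma ι_character (M X : C) :
    L.ι X ≫ character (L.action M) = dual X ◁ link M X ≫ ev X := by
  calc
    _ = 𝟙 _ ⊗≫ (L.ι X ▷ 𝟙_ C ≫ L.obj ◁ coev M) ⊗≫ L.action M ▷ dual M ≫ tev M := by
      rw [character]; monoidal
    _ = 𝟙 _ ⊗≫ (dual X ⊗ X) ◁ coev M ⊗≫ (L.ι X ▷ M ≫ L.action M) ▷ dual M ≫ tev M := by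
      rw [← whisker_exchange]; monoidal
    _ = 𝟙 _ ⊗≫ dual X ◁ (X ◁ coev M ⊗≫ ((β_ X M).hom ≫ (β_ M X).hom) ▷ dual M) ⊗≫
          (ev X ▷ (M ⊗ dual M) ≫ 𝟙_ C ◁ tev M) ⊗≫ 𝟙 _ := by
      rw [action, ι_descRight, actionApp]; monoidal
    _ = _ := by
      rw [← whisker_exchange, link_def]; monoidal

end CanonicalCoend

lemma link_shortExact {C : Type u} [Category.{v} C] [Abelian C] [MonoidalCategory C]
    [MonoidalPreadditive C] [BraidedCategory C] [RigidCategory C] [RibbonCategory C]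
    {S : ShortComplex C} (hS : S.ShortExact) (X : C) :
    link S.X₂ X = link S.X₁ X + link S.X₃ X := by
  -- The part of the loop after `coev M`; it is dinatural in `M` by naturality of both braidings and
  -- `tev_dinatural`.
  let t (M : C) : X ⊗ M ⊗ dual M ⟶ X :=
    𝟙 _ ⊗≫ ((β_ X M).hom ≫ (β_ M X).hom) ▷ dual M ⊗≫ X ◁ tev M ⊗≫ 𝟙 _
  have ht {M N : C} (f : M ⟶ N) : X ◁ f ▷ dual N ≫ t N = X ◁ M ◁ dualMap f ≫ t M := by
    calc
      _ = 𝟙 _ ⊗≫ (X ◁ f ≫ (β_ X N).hom ≫ (β_ N X).hom) ▷ dual N ⊗≫ X ◁ tev N ⊗≫ 𝟙 _ := by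
        dsimp only [t]; monoidal
      _ = 𝟙 _ ⊗≫ ((β_ X M).hom ≫ (β_ M X).hom) ▷ dual N ⊗≫
            X ◁ (f ▷ dual N ≫ tev N) ⊗≫ 𝟙 _ := by
        rw [BraidedCategory.braiding_naturality_right_assoc,
          BraidedCategory.braiding_naturality_left]
        monoidal
      _ = 𝟙 _ ⊗≫ (((β_ X M).hom ≫ (β_ M X).hom) ▷ dual N ≫ (X ⊗ M) ◁ dualMap f) ⊗≫
            X ◁ tev M ⊗≫ 𝟙 _ := by
        rw [← tev_dinatural]; monoidal
      _ = _ := by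
        rw [← whisker_exchange]; dsimp only [t]; monoidal
  have h (M : C) : link M X = (ρ_ X).inv ≫ X ◁ coev M ≫ t M := by
    rw [link_def]; dsimp only [t]; monoidal
  rw [h, h, h, trace_shortExact hS (t S.X₁) (t S.X₂) (t S.X₃) (ht S.f) (ht S.g),
    Preadditive.comp_add]

end Character

/-! ### Cocharacters as coevaluations followed by the dinatural family -/

section Cocharacter

variable {C : Type u} [Category.{v} C] [MonoidalCategory C] [BraidedCategory C]
  [RigidCategory C] [RibbonCategory C]

attribute [local instance] leftPairing

namespace CanonicalCoend

variable (L : CanonicalCoend C)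

/-- The pivotal map is exactly the comparison between `M`, a right dual of `dual M` through
`leftPairing`, and the chosen double dual. -/
lemma pivotal_ι (M : C) : pivotal M ▷ dual M ≫ L.ι (dual M) = L.ιOf (dual M) M := by
  have h : pivotal M = (rightDualIso (leftPairing M)
      (inferInstance : ExactPairing (dual M) (dual (dual M)))).hom := by
    change _ = (ρ_ M).inv ≫ M ◁ coev (dual M) ≫ M ◁ (𝟙 (dual M)) ▷ (dual (dual M)) ≫
      (α_ _ _ _).inv ≫ tev M ▷ _ ≫ (λ_ _).hom
    rw [pivotal]
    simp
  rw [h, ιOf]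

lemma cocharacter_coaction (M : C) :
    cocharacter (L.coaction M) = coev M ≫ L.ιOf (dual M) M := by
  have snake : tcoev M ▷ dual M ⊗≫ dual M ◁ tev M = ⊗𝟙.hom := by
    rw [← leftPairing_coevaluation]
    exact ExactPairing.evaluation_coevaluation'' (dual M) M
  calc
    _ = coev M ⊗≫ (M ◁ tcoev M) ▷ dual M ⊗≫
          (L.ιOf (dual M) M ▷ (M ⊗ dual M) ≫ L.obj ◁ tev M) ⊗≫ 𝟙 _ := by
      rw [cocharacter, coaction, pivotal_ι]; monoidal
    _ = coev M ⊗≫ M ◁ (tcoev M ▷ dual M ⊗≫ dual M ◁ tev M) ⊗≫ L.ιOf (dual M) M := by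
      rw [← whisker_exchange]; monoidal
    _ = _ := by
      rw [snake]; monoidal

/-- The cocharacter can be computed with an arbitrary two-sided dual `A` of `m`. -/
lemma coev_ιOf (M A : C) [ExactPairing M A] [ExactPairing A M] (h : ε_ A M = tevOf M A) :
    coev M ≫ L.ιOf (dual M) M = η_ M A ≫ L.ιOf A M := by
  -- By `h`, the comparison `A ⟶ dual M` respects the evaluations against `M`; dinaturality then
  -- transfers it from `ιOf` to the coevaluation.
  have := L.ιOf_condition (𝟙 M) (dualIso M A).hom (X := A) (A := M) (Y := dual M) (B := M) (by
    rw [h, ← dualIso_tev, id_whiskerRight, Category.id_comp]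
    rfl)
  rw [id_whiskerRight, Category.id_comp] at this
  rw [this, ← coev_dualIso M A, Category.assoc]

lemma cocharacter_unit : cocharacter (L.coaction (𝟙_ C)) = L.one := by
  rw [cocharacter_coaction, coev_ιOf L (𝟙_ C) (𝟙_ C) (by rw [tevOf_unit]; rfl), one,
    unitors_inv_equal]
  rfl

/-- The product braids `dual M` past `N ⊗ dual N`, which here comes from the unit through `coev N`.
Naturality trivialises this braiding. -/
lemma cocharacter_tensor (M N : C) :
    (λ_ (𝟙_ C)).inv ≫ cocharacter (L.coaction M) ▷ 𝟙_ C ≫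
      L.obj ◁ cocharacter (L.coaction N) ≫ L.mul = cocharacter (L.coaction (M ⊗ N)) := by
  have h : (λ_ (𝟙_ C)).inv ≫ (coev M ⊗ₘ coev N) ≫ mulBraid M (dual M) N (dual N) =
      η_ (M ⊗ N) (dual N ⊗ dual M) := by
    have := BraidedCategory.braiding_naturality_right (dual M) (coev N)
    rw [braiding_tensorUnit_right] at this
    calc
      _ = coev M ⊗≫ M ◁ (dual M ◁ coev N ≫ (β_ (dual M) (N ⊗ dual N)).hom) ⊗≫ 𝟙 _ := by
        rw [mulBraid, MonoidalCategory.tensorHom_def]; monoidal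
      _ = coev M ⊗≫ (M ◁ coev N) ▷ dual M ⊗≫ 𝟙 _ := by
        rw [this]; monoidal
      _ = _ := (ExactPairing.tensor_coevaluation).symm
  rw [cocharacter_coaction, cocharacter_coaction, cocharacter_coaction,
    -- The evaluation built from the two left pairings is nested, and `tevOf_tensor` identifies it
    -- with the left evaluation of `M ⊗ N`.
    coev_ιOf L (M ⊗ N) (dual N ⊗ dual M) (by
      rw [tevOf_tensor, ExactPairing.tensor_evaluation]; rfl), ← h,
    ← MonoidalCategory.tensorHom_def_assoc, ← tensorHom_comp_tensorHom]
  simp only [Category.assoc]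
  rw [ιOf_mul, mulOf]

end CanonicalCoend

lemma cocharacter_shortExact {C : Type u} [Category.{v} C] [Abelian C] [MonoidalCategory C]
    [MonoidalPreadditive C] [BraidedCategory C] [RigidCategory C] [RibbonCategory C]
    (L : CanonicalCoend C) {S : ShortComplex C} (hS : S.ShortExact) :
    cocharacter (L.coaction S.X₂) =
      cocharacter (L.coaction S.X₁) + cocharacter (L.coaction S.X₃) := by
  -- The case `A = 𝟙_ C` of `trace_shortExact`: dinaturality of `t` is that of the coend family
  -- along dual morphisms.
  let t (M : C) : 𝟙_ C ⊗ M ⊗ dual M ⟶ L.obj := (λ_ _).hom ≫ L.ιOf (dual M) M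
  have ht {M N : C} (f : M ⟶ N) : 𝟙_ C ◁ f ▷ dual N ≫ t N = 𝟙_ C ◁ M ◁ dualMap f ≫ t M := by
    dsimp only [t]
    rw [leftUnitor_naturality_assoc, leftUnitor_naturality_assoc,
      L.ιOf_condition f (dualMap f) (tev_dinatural f).symm]
  have h (M : C) : cocharacter (L.coaction M) = (λ_ (𝟙_ C)).inv ≫ 𝟙_ C ◁ coev M ≫ t M := by
    rw [L.cocharacter_coaction]
    dsimp only [t]
    rw [leftUnitor_naturality_assoc, Iso.inv_hom_id_assoc]
  rw [h, h, h, trace_shortExact hS (t S.X₁) (t S.X₂) (t S.X₃) (ht S.f) (ht S.g),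
    Preadditive.comp_add]

end Cocharacter

/-! ### Translation into the convolution rings -/

section Multiplicativity

variable {C : Type u} [Category.{v} C] [MonoidalCategory C] [RigidCategory C] [BraidedCategory C]
  [RibbonCategory C] (L : CanonicalCoend C)

namespace CanonicalCoend

lemma chi_unit : L.chi (𝟙_ C) = 1 :=
  -- The convolution unit is the counit followed by the unit of the trivial algebra, which is an
  -- identity.
  L.hom_ext (f := character (L.action (𝟙_ C))) (g := L.counit ≫ 𝟙 _) (fun X => by
    rw [Category.comp_id, ι_counit, ι_character, link_unit]
    simp)

lemma chi_tensor (M N : C) : L.chi (M ⊗ N) = L.chi M * L.chi N :=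
  L.hom_ext (f := character (L.action (M ⊗ N)))
    (g := L.comul ≫ character (L.action M) ▷ L.obj ≫
      𝟙_ C ◁ character (L.action N) ≫ (λ_ (𝟙_ C)).hom) (fun X => by
    rw [L.ι_comul_forms (L.ι_character M X) (L.ι_character N X), ι_character, link_tensor])

lemma cochi_unit : L.cochi (𝟙_ C) = 1 :=
  L.cocharacter_unit.trans (Category.id_comp L.one).symm

lemma cochi_tensor (M N : C) : L.cochi (M ⊗ N) = L.cochi M * L.cochi N :=
  (L.cocharacter_tensor M N).symm

end CanonicalCoend

end Multiplicativity

/-! ### The two ring homomorphisms -/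

section RingHoms

variable {C : Type u} [Category.{v} C] [Abelian C] [MonoidalCategory C] [MonoidalPreadditive C]
  [RigidCategory C] [BraidedCategory C] [RibbonCategory C] (L : CanonicalCoend C)

namespace CanonicalCoend

lemma chi_shortExact {S : ShortComplex C} (hS : S.ShortExact) :
    L.chi S.X₂ = L.chi S.X₁ + L.chi S.X₃ :=
  L.hom_ext (f := character (L.action S.X₂))
    (g := character (L.action S.X₁) + character (L.action S.X₃)) (fun X => by
      rw [Preadditive.comp_add, ι_character, ι_character, ι_character, link_shortExact hS,
        MonoidalPreadditive.whiskerLeft_add, Preadditive.add_comp])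

/-- The ring homomorphism `[m] ↦ χ^L_m`. -/
def chiHom : K0 C →+* Conv L.obj (𝟙_ C) :=
  K0.liftRingHom L.chi (fun _ hS => L.chi_shortExact hS) L.chi_unit L.chi_tensor

lemma chiHom_mk (M : C) : L.chiHom (K0.mk M) = L.chi M :=
  K0.lift_mk L.chi (fun _ hS => L.chi_shortExact hS) M

lemma cochi_shortExact {S : ShortComplex C} (hS : S.ShortExact) :
    L.cochi S.X₂ = L.cochi S.X₁ + L.cochi S.X₃ :=
  cocharacter_shortExact L hS

/-- The ring homomorphism `[m] ↦ χ̂^L_m`. -/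
def cochiHom : K0 C →+* Conv (𝟙_ C) L.obj :=
  K0.liftRingHom L.cochi (fun _ hS => L.cochi_shortExact hS) L.cochi_unit L.cochi_tensor

lemma cochiHom_mk (M : C) : L.cochiHom (K0.mk M) = L.cochi M :=
  K0.lift_mk L.cochi (fun _ hS => L.cochi_shortExact hS) M

end CanonicalCoend

end RingHoms

end FiniteRibbon

end

theorem mainTheorem4 {k : Type w} [Field k] [IsAlgClosed k]
    {C : Type u} [Category.{v} C] [Abelian C] [Linear k C]
    [MonoidalCategory C] [MonoidalPreadditive C] [MonoidalLinear k C] [RigidCategory C]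
    [BraidedCategory C] [FiniteRibbon.RibbonCategory C]
    [FiniteRibbon.IsFiniteCategory k C] [Simple (𝟙_ C)] :
    Nonempty (FiniteRibbon.CanonicalCoend C) ∧
    ∀ L : FiniteRibbon.CanonicalCoend C,
      (∃ f : FiniteRibbon.K0 C →+* Conv L.obj (𝟙_ C),
        ∀ m : C, f (FiniteRibbon.K0.mk m) = L.chi m) ∧
      (∃ g : FiniteRibbon.K0 C →+* Conv (𝟙_ C) L.obj,
        ∀ m : C, g (FiniteRibbon.K0.mk m) = L.cochi m) := by
  exact ⟨FiniteRibbon.exists_coend k, fun L =>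
    ⟨⟨L.chiHom, L.chiHom_mk⟩, ⟨L.cochiHom, L.cochiHom_mk⟩⟩⟩
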